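/- **Theorem.** Let $(M,g)$ and $(N,g_N)$ be smooth (finite-dimensional) Riemannian manifolds with $\dim M>\dim N$, and let $\pi:(M,g)\to(N,g_N)$ be a Riemannian submersion, i.e. a smooth surjection of rank $\dim N$ whose differential $\pi_*$ preserves the lengths of vectors orthogonal to $\ker\pi_*$. Let $\nabla$ be the Levi-Civita connection of $g$, and suppose that the vertical distribution $\mathcal V=\ker\pi_*$ is parallel, i.e. $\nabla_XW$ is vertical for every vector field $X$ and every vertical vector field $W$. Let $V$ be a smooth vertical vector field on $M$, $\eta$ a smooth one-form on $M$, and $\lambda,\mu\in\mathbb R$. For a Riemannian metric $h$ write $S_h$ for its Ricci tensor and $R_h$ for its scalar curvature. The data $(g,V,\eta,\lambda,\mu)$ is called an *$\eta$-Ricci-Yamabe soliton of type $(\alpha,\beta)$* if $$\mathcal L_Vg+2\alpha S_g+(2\lambda-\beta R_g)\,g+2\mu\,\eta\otimes\eta=0 .$$ Let $q\in N$, let $F=\pi^{-1}(q)$ be the fiber over $q$, an embedded submanifold of $M$ of dimension $\dim M-\dim N$, and let $\hat g$ and $\hat\eta$ be the restrictions (pull-backs) of $g$ and $\eta$ to $F$.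 Then $V$ restricts to a smooth vector field $\hat V$ on $F$, and: 1. If $(g,V,\eta,\lambda,\mu)$ is an $\eta$-Ricci-Yamabe soliton of type $(1,0)$, then $F$ is an $\eta$-Ricci soliton: $\mathcal L_{\hat V}\hat g+2S_{\hat g}+2\lambda\hat g+2\mu\,\hat\eta\otimes\hat\eta=0$. 2. If in addition $\mu=0$, then $F$ is a Ricci soliton: $\mathcal L_{\hat V}\hat g+2S_{\hat g}+2\lambda\hat g=0$. 3. If $(g,V,\eta,\lambda,\mu)$ is an $\eta$-Ricci-Yamabe soliton of type $(0,1)$, then $F$ is an $\eta$-Yamabe soliton with the constant $\hat\lambda=\lambda-\tfrac12R_{g_N}(q)$: $\mathcal L_{\hat V}\hat g+(2\hat\lambda-R_{\hat g})\hat g+2\mu\,\hat\eta\otimes\hat\eta=0$. 4. If in addition $\mu=0$, then $F$ is a quasi-Yamabe soliton with the same constant $\hat\lambda=\lambda-\tfrac12R_{g_N}(q)$: $\mathcal L_{\hat V}\hat g+(2\hat\lambda-R_{\hat g})\hat g=0$. -/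

import Mathlib

open scoped Manifold ContDiff Topology

noncomputable section

namespace RiemSoliton

section Local

variable {E : Type*} [NormedAddCommGroup E] [NormedSpace ℝ E]

/-- The Christoffel map of a field `G` of bilinear forms on a vector space: `Γ(u, v)` is the vector with
`G(Γ(u, v), w) = (∂_u G(v, w) + ∂_v G(u, w) - ∂_w G(u, v)) / 2` for all `w`. -/
def christoffel (G : E → E →L[ℝ] E →L[ℝ] ℝ) (y u v : E) : E :=
  (G y).inverse ((1 / 2 : ℝ) •
    (fderiv ℝ (fun z => G z v) y u + fderiv ℝ (fun z => G z u) y v - fderiv ℝ (fun z => G z u v) y))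

/-- The curvature `R(u, v)w = ∇_u ∇_v w - ∇_v ∇_u w` (for constant fields `u, v, w`). -/
def curvature (G : E → E →L[ℝ] E →L[ℝ] ℝ) (y u v w : E) : E :=
  fderiv ℝ (fun z => christoffel G z v w) y u - fderiv ℝ (fun z => christoffel G z u w) y v
    + christoffel G y u (christoffel G y v w) - christoffel G y v (christoffel G y u w)

variable [FiniteDimensional ℝ E]

/-- The Ricci form `Ric(v, w) = tr (u ↦ R(u, v)w)`, the trace being taken in a basis. -/
def localRicci (G : E → E →L[ℝ] E →L[ℝ] ℝ) (y v w : E) : ℝ :=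
  ∑ i, (Module.finBasis ℝ E).coord i (curvature G y (Module.finBasis ℝ E i) v w)

/-- The scalar curvature `∑ Ric(b_i, ♯b^i)`, i.e. the `G`-trace of `Ric`, where `(b_i)` is a basis
with dual basis `(b^i)` and `♯b^i` is the vector that represents `b^i` with respect to `G`. -/
def localScalar (G : E → E →L[ℝ] E →L[ℝ] ℝ) (y : E) : ℝ :=
  ∑ i, localRicci G y (Module.finBasis ℝ E i)
    ((G y).inverse (LinearMap.toContinuousLinearMap ((Module.finBasis ℝ E).coord i)))

end Local

section Mfd

variable {E : Type*} [NormedAddCommGroup E] [NormedSpace ℝ E]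
  {M : Type*} [TopologicalSpace M] [ChartedSpace E M]

/-- A smooth Riemannian metric on `M`. -/
abbrev RMetric (E : Type*) [NormedAddCommGroup E] [NormedSpace ℝ E]
    (M : Type*) [TopologicalSpace M] [ChartedSpace E M] [IsManifold 𝓘(ℝ, E) ∞ M] :=
  Bundle.ContMDiffRiemannianMetric 𝓘(ℝ, E) ∞ E (TangentSpace 𝓘(ℝ, E) : M → Type _)

/-- A smooth vector field on `M`. -/
abbrev VField (E : Type*) [NormedAddCommGroup E] [NormedSpace ℝ E]
    (M : Type*) [TopologicalSpace M] [ChartedSpace E M] [IsManifold 𝓘(ℝ, E) ∞ M] :=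
  ContMDiffSection 𝓘(ℝ, E) E ∞ (TangentSpace 𝓘(ℝ, E) : M → Type _)

/-- A smooth one-form on `M`. -/
abbrev OneForm (E : Type*) [NormedAddCommGroup E] [NormedSpace ℝ E]
    (M : Type*) [TopologicalSpace M] [ChartedSpace E M] [IsManifold 𝓘(ℝ, E) ∞ M] :=
  ContMDiffSection 𝓘(ℝ, E) (E →L[ℝ] ℝ) ∞
    (fun p : M => TangentSpace 𝓘(ℝ, E) p →L[ℝ] Bundle.Trivial M ℝ p)

/-- The derivative at `p` of the chart centered at `p`. -/
def toChart (p : M) : TangentSpace 𝓘(ℝ, E) p →L[ℝ] E :=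
  mfderiv 𝓘(ℝ, E) 𝓘(ℝ, E) (chartAt E p) p

/-- The derivative at `y` of the inverse of the chart centered at `p`. -/
def fromChart (p : M) (y : E) : E →L[ℝ] TangentSpace 𝓘(ℝ, E) ((chartAt E p).symm y) :=
  mfderiv 𝓘(ℝ, E) 𝓘(ℝ, E) (chartAt E p).symm y

variable [IsManifold 𝓘(ℝ, E) ∞ M]

/-- The metric, written in the chart centered at `p`. -/
def chartMetric (g : RMetric E M) (p : M) (y : E) : E →L[ℝ] E →L[ℝ] ℝ :=
  (ContinuousLinearMap.precomp ℝ (fromChart p y)).comp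
    ((g.inner ((chartAt E p).symm y)).comp (fromChart p y))

/-- A vector field, written in the chart centered at `p`. -/
def chartField (V : Π x : M, TangentSpace 𝓘(ℝ, E) x) (p : M) (y : E) : E :=
  (fromChart p y).inverse (V ((chartAt E p).symm y))

/-- The covariant derivative `∇_u V` at `p`, for the Levi-Civita connection of `g`. -/
def covDeriv (g : RMetric E M) (V : Π x : M, TangentSpace 𝓘(ℝ, E) x) (p : M)
    (u : TangentSpace 𝓘(ℝ, E) p) : TangentSpace 𝓘(ℝ, E) p :=
  (toChart p).inverse
    (fderiv ℝ (chartField V p) (chartAt E p p) (toChart p u) +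
      christoffel (chartMetric g p) (chartAt E p p) (toChart p u)
        (chartField V p (chartAt E p p)))

/-- The Lie derivative `(L_V g)(u, v)` at `p`. In a chart it is
`V(g(u, v)) - g([V, u], v) - g(u, [V, v])` for constant fields `u, v`, and `[V, u] = -D_u V`. -/
def lieMetric (g : RMetric E M) (V : Π x : M, TangentSpace 𝓘(ℝ, E) x) (p : M)
    (u v : TangentSpace 𝓘(ℝ, E) p) : ℝ :=
  fderiv ℝ (fun y => chartMetric g p y (toChart p u) (toChart p v)) (chartAt E p p)
      (chartField V p (chartAt E p p))
    + chartMetric g p (chartAt E p p)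
        (fderiv ℝ (chartField V p) (chartAt E p p) (toChart p u)) (toChart p v)
    + chartMetric g p (chartAt E p p)
        (toChart p u) (fderiv ℝ (chartField V p) (chartAt E p p) (toChart p v))

variable [FiniteDimensional ℝ E]

/-- The Ricci tensor of `g` at `p`. -/
def ricci (g : RMetric E M) (p : M) (u v : TangentSpace 𝓘(ℝ, E) p) : ℝ :=
  localRicci (chartMetric g p) (chartAt E p p) (toChart p u) (toChart p v)

/-- The scalar curvature of `g` at `p`. -/
def scalar (g : RMetric E M) (p : M) : ℝ :=
  localScalar (chartMetric g p) (chartAt E p p)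

end Mfd

section Submanifold

variable {E : Type*} [NormedAddCommGroup E] [NormedSpace ℝ E]
  {M : Type*} [TopologicalSpace M] [ChartedSpace E M]
  {E' : Type*} [NormedAddCommGroup E'] [NormedSpace ℝ E']
  {M' : Type*} [TopologicalSpace M'] [ChartedSpace E' M']

theorem injective_mfderiv {f : M → M'} (hf : Manifold.IsSmoothEmbedding 𝓘(ℝ, E) 𝓘(ℝ, E') ∞ f)
    (x : M) : Function.Injective (mfderiv 𝓘(ℝ, E) 𝓘(ℝ, E') f x) := by
  have h := hf.isImmersion.isImmersionAt x
  set L : E' → E := fun z => (h.equiv.symm z).1 with hL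
  have hev : (h.domChart.symm ∘ L ∘ h.codChart ∘ f) =ᶠ[𝓝 x] id := by
    filter_upwards [h.domChart.open_source.mem_nhds h.mem_domChart_source] with z hz
    have := h.writtenInCharts (show h.domChart z ∈ (h.domChart.extend 𝓘(ℝ, E)).target by simpa using h.domChart.map_source hz)
    simp only [Function.comp, OpenPartialHomeomorph.extend_coe, OpenPartialHomeomorph.extend_coe_symm, modelWithCornersSelf_coe, modelWithCornersSelf_coe_symm, id, h.domChart.left_inv hz] at this
    simp [hL, Function.comp, this, h.domChart.left_inv hz]
  have hfx : MDifferentiableAt 𝓘(ℝ, E) 𝓘(ℝ, E') f x :=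
    hf.contMDiff.mdifferentiableAt (by simp)
  have h1 : MDifferentiableAt 𝓘(ℝ, E') 𝓘(ℝ, E') h.codChart (f x) :=
    ((contMDiffOn_of_mem_maximalAtlas h.codChart_mem_maximalAtlas).contMDiffAt
      (h.codChart.open_source.mem_nhds h.mem_codChart_source)).mdifferentiableAt (by simp)
  have h2 : MDifferentiableAt 𝓘(ℝ, E') 𝓘(ℝ, E) L (h.codChart (f x)) := by
    apply DifferentiableAt.mdifferentiableAt
    exact (ContinuousLinearMap.fst ℝ E h.complement).differentiableAt.comp _
      h.equiv.symm.differentiableAt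
  have hx' : L (h.codChart (f x)) = h.domChart x := by
    have := h.writtenInCharts
      (show h.domChart x ∈ (h.domChart.extend 𝓘(ℝ, E)).target by simpa using h.domChart.map_source h.mem_domChart_source)
    simp only [Function.comp, OpenPartialHomeomorph.extend_coe, OpenPartialHomeomorph.extend_coe_symm, modelWithCornersSelf_coe, modelWithCornersSelf_coe_symm, id, h.domChart.left_inv h.mem_domChart_source] at this
    simp [hL, this]
  have h3 : MDifferentiableAt 𝓘(ℝ, E) 𝓘(ℝ, E) h.domChart.symm (L (h.codChart (f x))) := by
    rw [hx']
    exact ((contMDiffOn_symm_of_mem_maximalAtlas h.domChart_mem_maximalAtlas).contMDiffAt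
      (h.domChart.open_target.mem_nhds
        (h.domChart.map_source h.mem_domChart_source))).mdifferentiableAt (by simp)
  have hder : (mfderiv 𝓘(ℝ, E') 𝓘(ℝ, E) (h.domChart.symm ∘ L ∘ h.codChart) (f x)).comp
      (mfderiv 𝓘(ℝ, E) 𝓘(ℝ, E') f x) = mfderiv 𝓘(ℝ, E) 𝓘(ℝ, E) (@id M) x := by
    rw [← hev.mfderiv_eq, ← mfderiv_comp x (h3.comp (f x) (h2.comp (f x) h1)) hfx]
    rfl
  intro a b hab
  have ha := DFunLike.congr_fun hder a
  have hb := DFunLike.congr_fun hder b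
  rw [mfderiv_id] at ha hb
  exact ha.symm.trans ((congrArg _ hab).trans hb)

theorem isVonNBounded_posDef [FiniteDimensional ℝ E] (B : E →L[ℝ] E →L[ℝ] ℝ)
    (hB : ∀ v, v ≠ 0 → 0 < B v v) : Bornology.IsVonNBounded ℝ {v : E | B v v < 1} := by
  rw [NormedSpace.isVonNBounded_iff]
  rcases subsingleton_or_nontrivial E with hE | hE
  · exact (Set.toFinite _).isBounded
  obtain ⟨v₀, hv₀, hmin⟩ := (isCompact_sphere (0 : E) 1).exists_isMinOn
    ((NormedSpace.sphere_nonempty (x := (0 : E))).2 zero_le_one)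
    (f := fun v => B v v) (by fun_prop)
  have hc : 0 < B v₀ v₀ := hB _ (by rintro rfl; simp at hv₀)
  rw [isBounded_iff_forall_norm_le]
  refine ⟨Real.sqrt (1 / B v₀ v₀), fun v hv => ?_⟩
  rcases eq_or_ne v 0 with rfl | hv0
  · simp 
  apply Real.le_sqrt_of_sq_le
  rw [le_div_iff₀ hc]
  have hn : 0 < ‖v‖ := norm_pos_iff.2 hv0
  have := isMinOn_iff.1 hmin (‖v‖⁻¹ • v) (by simp [norm_smul, hn.ne'])
  simp only [map_smul, smul_apply, smul_eq_mul] at this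
  have hv1 : B v v < 1 := hv
  have h4 : ‖v‖ ^ 2 * (‖v‖⁻¹ * (‖v‖⁻¹ * B v v)) = B v v := by field_simp
  nlinarith [mul_le_mul_of_nonneg_left this (sq_nonneg ‖v‖)]
variable [IsManifold 𝓘(ℝ, E) ∞ M] [IsManifold 𝓘(ℝ, E') ∞ M']

theorem contMDiff_pullback_form (η : OneForm E' M') {f : M → M'}
    (hf : ContMDiff 𝓘(ℝ, E) 𝓘(ℝ, E') ∞ f) :
    ContMDiff 𝓘(ℝ, E) (𝓘(ℝ, E).prod 𝓘(ℝ, E →L[ℝ] ℝ)) ∞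
      (fun x => Bundle.TotalSpace.mk' (E →L[ℝ] ℝ)
        (E := fun p : M => TangentSpace 𝓘(ℝ, E) p →L[ℝ] Bundle.Trivial M ℝ p) x
        ((η (f x)).comp (mfderiv 𝓘(ℝ, E) 𝓘(ℝ, E') f x))) := by
  intro x₀
  rw [contMDiffAt_hom_bundle]
  refine ⟨contMDiffAt_id, ?_⟩
  have hD := (hf x₀).mfderiv_const (m := ∞) (by simp)
  have hη := ((contMDiffAt_hom_bundle _).1 (η.contMDiff (f x₀))).2.comp x₀ (hf x₀)
  refine (hη.clm_comp hD).congr_of_eventuallyEq ?_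
  have A : ∀ᶠ x in 𝓝 x₀, x ∈ (trivializationAt E (TangentSpace 𝓘(ℝ, E)) x₀).baseSet :=
    (trivializationAt E (TangentSpace 𝓘(ℝ, E)) x₀).open_baseSet.mem_nhds
      (FiberBundle.mem_baseSet_trivializationAt' x₀)
  have A' : ∀ᶠ x in 𝓝 x₀, f x ∈ (trivializationAt E' (TangentSpace 𝓘(ℝ, E')) (f x₀)).baseSet :=
    hf.continuous.continuousAt.preimage_mem_nhds
      ((trivializationAt E' (TangentSpace 𝓘(ℝ, E')) (f x₀)).open_baseSet.mem_nhds
      (FiberBundle.mem_baseSet_trivializationAt' (f x₀)))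
  filter_upwards [A, A'] with x hx hx'
  ext v
  simp only [inTangentCoordinates, Function.comp, id]
  rw [ContinuousLinearMap.comp_apply, ContinuousLinearMap.inCoordinates_eq hx hx',
    ContinuousLinearMap.inCoordinates_eq hx (by simp),
    ContinuousLinearMap.inCoordinates_eq hx' (by simp)]
  simp [Bundle.Trivialization.symm_apply_apply_mk _ hx']

theorem contMDiff_pullback_metric (g : RMetric E' M') {f : M → M'}
    (hf : ContMDiff 𝓘(ℝ, E) 𝓘(ℝ, E') ∞ f) :
    ContMDiff 𝓘(ℝ, E) (𝓘(ℝ, E).prod 𝓘(ℝ, E →L[ℝ] E →L[ℝ] ℝ)) ∞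
      (fun x => Bundle.TotalSpace.mk' (E →L[ℝ] E →L[ℝ] ℝ)
        (E := fun p : M => TangentSpace 𝓘(ℝ, E) p →L[ℝ] TangentSpace 𝓘(ℝ, E) p →L[ℝ] ℝ) x
        ((ContinuousLinearMap.precomp ℝ (mfderiv 𝓘(ℝ, E) 𝓘(ℝ, E') f x)).comp
          ((g.inner (f x)).comp (mfderiv 𝓘(ℝ, E) 𝓘(ℝ, E') f x)))) := by
  intro x₀
  rw [contMDiffAt_hom_bundle]
  refine ⟨contMDiffAt_id, ?_⟩
  have hD := (hf x₀).mfderiv_const (m := ∞) (by simp)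
  have hη := ((contMDiffAt_hom_bundle _).1 (g.contMDiff (f x₀))).2.comp x₀ (hf x₀)
  refine ((hD.clm_precomp (F₃ := ℝ)).clm_comp (hη.clm_comp hD)).congr_of_eventuallyEq ?_
  have A : ∀ᶠ x in 𝓝 x₀, x ∈ (trivializationAt E (TangentSpace 𝓘(ℝ, E)) x₀).baseSet :=
    (trivializationAt E (TangentSpace 𝓘(ℝ, E)) x₀).open_baseSet.mem_nhds
      (FiberBundle.mem_baseSet_trivializationAt' x₀)
  have A' : ∀ᶠ x in 𝓝 x₀, f x ∈ (trivializationAt E' (TangentSpace 𝓘(ℝ, E')) (f x₀)).baseSet :=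
    hf.continuous.continuousAt.preimage_mem_nhds
      ((trivializationAt E' (TangentSpace 𝓘(ℝ, E')) (f x₀)).open_baseSet.mem_nhds
      (FiberBundle.mem_baseSet_trivializationAt' (f x₀)))
  filter_upwards [A, A'] with x hx hx'
  ext v w
  have e1 := inCoordinates_apply_eq₂ (F₃ := ℝ) (E₃ := Bundle.Trivial M ℝ) (ϕ := ((ContinuousLinearMap.precomp ℝ (mfderiv 𝓘(ℝ, E) 𝓘(ℝ, E') f x)).comp
          ((g.inner (f x)).comp (mfderiv 𝓘(ℝ, E) 𝓘(ℝ, E') f x)))) (v := v) (w := w) hx hx (by simp)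
  refine e1.trans ?_
  have e2 := fun a b => inCoordinates_apply_eq₂ (F₃ := ℝ) (E₃ := Bundle.Trivial M' ℝ) (ϕ := g.inner (f x)) (v := a) (w := b) hx' hx' (by simp)
  refine Eq.trans ?_ (e2 _ _).symm
  simp only [inTangentCoordinates, id]
  rw [ContinuousLinearMap.inCoordinates_eq hx hx']
  simp [Bundle.Trivialization.symm_apply_apply_mk _ hx']


/-- The pull-back of a one-form along a smooth map (for an inclusion: its restriction). -/
def inducedOneForm (η : OneForm E' M') (f : M → M')
    (hf : ContMDiff 𝓘(ℝ, E) 𝓘(ℝ, E') ∞ f) : OneForm E M where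
  toFun x := (η (f x)).comp (mfderiv 𝓘(ℝ, E) 𝓘(ℝ, E') f x)
  contMDiff_toFun := contMDiff_pullback_form η hf

/-- The metric `f^*g` induced on a submanifold by its embedding `f`. -/
def inducedMetric [FiniteDimensional ℝ E] (g : RMetric E' M') (f : M → M')
    (hf : Manifold.IsSmoothEmbedding 𝓘(ℝ, E) 𝓘(ℝ, E') ∞ f) : RMetric E M where
  inner x := (ContinuousLinearMap.precomp ℝ (mfderiv 𝓘(ℝ, E) 𝓘(ℝ, E') f x)).comp
    ((g.inner (f x)).comp (mfderiv 𝓘(ℝ, E) 𝓘(ℝ, E') f x))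
  symm x v w := g.symm _ _ _
  pos x v hv := g.pos _ _ (by
    rw [← map_zero (mfderiv 𝓘(ℝ, E) 𝓘(ℝ, E') f x)]
    exact (injective_mfderiv hf x).ne hv)
  isVonNBounded x := isVonNBounded_posDef (E := E)
    ((ContinuousLinearMap.precomp ℝ (mfderiv 𝓘(ℝ, E) 𝓘(ℝ, E') f x)).comp
      ((g.inner (f x)).comp (mfderiv 𝓘(ℝ, E) 𝓘(ℝ, E') f x)))
    (fun v hv => g.pos _ _ (by
      rw [← map_zero (mfderiv 𝓘(ℝ, E) 𝓘(ℝ, E') f x)]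
      exact (injective_mfderiv hf x).ne hv))
  contMDiff := contMDiff_pullback_metric g hf.contMDiff

theorem inducedMetric_apply [FiniteDimensional ℝ E] (g : RMetric E' M') (f : M → M')
    (hf : Manifold.IsSmoothEmbedding 𝓘(ℝ, E) 𝓘(ℝ, E') ∞ f) (x : M)
    (u v : TangentSpace 𝓘(ℝ, E) x) :
    (inducedMetric g f hf).inner x u v =
      g.inner (f x) (mfderiv 𝓘(ℝ, E) 𝓘(ℝ, E') f x u) (mfderiv 𝓘(ℝ, E) 𝓘(ℝ, E') f x v) := rfl

end Submanifold

section Submersion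

variable {E : Type*} [NormedAddCommGroup E] [NormedSpace ℝ E]
  {M : Type*} [TopologicalSpace M] [ChartedSpace E M] [IsManifold 𝓘(ℝ, E) ∞ M]
  {E' : Type*} [NormedAddCommGroup E'] [NormedSpace ℝ E']
  {N : Type*} [TopologicalSpace N] [ChartedSpace E' N] [IsManifold 𝓘(ℝ, E') ∞ N]

/-- A Riemannian submersion: a smooth surjection of rank `dim N < dim M` whose derivative preserves
the lengths of the horizontal vectors, i.e. of the vectors orthogonal to its kernel. -/
structure IsRiemannianSubmersion (g : RMetric E M) (gN : RMetric E' N) (π : M → N) : Prop where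
  finrank_lt : Module.finrank ℝ E' < Module.finrank ℝ E
  contMDiff : ContMDiff 𝓘(ℝ, E) 𝓘(ℝ, E') ∞ π
  surjective : Function.Surjective π
  surjective_mfderiv : ∀ p, Function.Surjective (mfderiv 𝓘(ℝ, E) 𝓘(ℝ, E') π p)
  isometry : ∀ (p : M) (u : TangentSpace 𝓘(ℝ, E) p),
    (∀ w, mfderiv 𝓘(ℝ, E) 𝓘(ℝ, E') π p w = 0 → g.inner p u w = 0) →
    gN.inner (π p) (mfderiv 𝓘(ℝ, E) 𝓘(ℝ, E') π p u) (mfderiv 𝓘(ℝ, E) 𝓘(ℝ, E') π p u)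
      = g.inner p u u

/-- The vector field `V` is vertical on `U`: it is tangent to the fibers of `π`. -/
def IsVerticalOn (π : M → N) (V : Π x : M, TangentSpace 𝓘(ℝ, E) x) (U : Set M) : Prop :=
  ∀ p ∈ U, mfderiv 𝓘(ℝ, E) 𝓘(ℝ, E') π p (V p) = 0

/-- The vertical distribution `ker π_*` is parallel: `∇_u W` is vertical for every tangent vector
`u` and every smooth local section `W` of `ker π_*`. -/
def VerticalParallel (g : RMetric E M) (π : M → N) : Prop :=
  ∀ (U : Set M) (W : Π x : M, TangentSpace 𝓘(ℝ, E) x), IsOpen U →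
    ContMDiffOn 𝓘(ℝ, E) 𝓘(ℝ, E).tangent ∞
      (fun x => (⟨x, W x⟩ : TangentBundle 𝓘(ℝ, E) M)) U →
    IsVerticalOn (E' := E') π W U →
    ∀ p ∈ U, ∀ u : TangentSpace 𝓘(ℝ, E) p,
      mfderiv 𝓘(ℝ, E) 𝓘(ℝ, E') π p (covDeriv g W p u) = 0

end Submersion

section Soliton

variable {E : Type*} [NormedAddCommGroup E] [NormedSpace ℝ E] [FiniteDimensional ℝ E]
  {M : Type*} [TopologicalSpace M] [ChartedSpace E M] [IsManifold 𝓘(ℝ, E) ∞ M]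

/-- `η`-Ricci-Yamabe soliton of type `(α, β)`:
`L_V g + 2 α Ric + (2 λ - β R) g + 2 μ η ⊗ η = 0`. -/
def IsEtaRicciYamabeSoliton (g : RMetric E M) (V : VField E M) (η : OneForm E M)
    (lam mu α β : ℝ) : Prop :=
  ∀ (p : M) (u v : TangentSpace 𝓘(ℝ, E) p),
    lieMetric g V p u v + 2 * α * ricci g p u v + (2 * lam - β * scalar g p) * g.inner p u v
      + 2 * mu * ((η p u : ℝ) * (η p v : ℝ)) = 0

/-- `η`-Ricci soliton: `L_V g + 2 Ric + 2 λ g + 2 μ η ⊗ η = 0`. -/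
def IsEtaRicciSoliton (g : RMetric E M) (V : VField E M) (η : OneForm E M) (lam mu : ℝ) : Prop :=
  ∀ (p : M) (u v : TangentSpace 𝓘(ℝ, E) p),
    lieMetric g V p u v + 2 * ricci g p u v + 2 * lam * g.inner p u v
      + 2 * mu * ((η p u : ℝ) * (η p v : ℝ)) = 0

/-- Ricci soliton: `L_V g + 2 Ric + 2 λ g = 0`. -/
def IsRicciSoliton (g : RMetric E M) (V : VField E M) (lam : ℝ) : Prop :=
  ∀ (p : M) (u v : TangentSpace 𝓘(ℝ, E) p),
    lieMetric g V p u v + 2 * ricci g p u v + 2 * lam * g.inner p u v = 0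

/-- `η`-Yamabe soliton: `L_V g + (2 λ - R) g + 2 μ η ⊗ η = 0`. -/
def IsEtaYamabeSoliton (g : RMetric E M) (V : VField E M) (η : OneForm E M) (lam mu : ℝ) : Prop :=
  ∀ (p : M) (u v : TangentSpace 𝓘(ℝ, E) p),
    lieMetric g V p u v + (2 * lam - scalar g p) * g.inner p u v
      + 2 * mu * ((η p u : ℝ) * (η p v : ℝ)) = 0

/-- Quasi-Yamabe soliton: `L_V g + (2 λ - R) g = 0`. -/
def IsQuasiYamabeSoliton (g : RMetric E M) (V : VField E M) (lam : ℝ) : Prop :=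
  ∀ (p : M) (u v : TangentSpace 𝓘(ℝ, E) p),
    lieMetric g V p u v + (2 * lam - scalar g p) * g.inner p u v = 0

end Soliton

end RiemSoliton

end

open RiemSoliton

/-! When the vertical distribution is parallel, both the submersion `π` and the inclusion `i` of a
fiber preserve the Levi-Civita connections, and smooth maps that do so near a point commute with
curvature there. The rest is linear algebra on the splitting of the tangent space into vertical and
horizontal vectors.

For `π`, let `C = ∇dπ`, a symmetric bilinear form with values in the tangent space of the base.
Parallelism says that `C(u, w) = 0` for vertical `w`. Let `H` be the horizontal projection.
Differentiating `⟨dπ u, dπ v⟩ = g(H u, H v)` makes `⟨C(w, u), dπ v⟩` skew in `u, v`. It is also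
symmetric in `w, u`, so it vanishes, and `C = 0` because `dπ` is onto (`IsSubmersionOn.isAffineAt`).
For `i`, the second fundamental form is normal to the fiber by the Koszul formula
(`christoffel_of_isometric`). It is also vertical, because `π ∘ i` is constant and `C` vanishes on
vertical vectors. Hence it is zero (`IsFiberOn.isAffineAt`).

By `IsAffineAt.map_connCurvature`, `di` carries the curvature of the fiber to that of `M`, and `dπ`
carries the latter to that of `N`. In the traces the mixed blocks contribute nothing. So the Ricci
form of `M` restricts to that of the fiber and agrees on horizontal vectors with that of the base,
and `R_g = R_F + R_N` (`IsFiberOn.connRicci_fiber`, `IsFiberOn.connRicci_horizontal`,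
`IsFiberOn.localScalar_eq`). The Lie derivative restricts because `V` is tangent to the fiber
(`lieDeriv_naturality`). Restricting the soliton equation to the fiber gives the result; in type
`(0, 1)` the number `R_N(q)` is absorbed into `λ`.

These computations take place in vector spaces and are transported through charts. Since the
covariant derivative at a point is defined in the chart centered there, parallelism has to be moved
to one fixed chart (`VerticalParallel.isVerticalParallelOn_localRep`). -/

set_option maxSynthPendingDepth 3

namespace RiemSoliton

/-! ### Levi-Civita connection and curvature in coordinates; isometric and affine maps. -/

section LocalTheory

variable {E : Type*} [NormedAddCommGroup E] [NormedSpace ℝ E]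
  {E₁ : Type*} [NormedAddCommGroup E₁] [NormedSpace ℝ E₁]
  {E₂ : Type*} [NormedAddCommGroup E₂] [NormedSpace ℝ E₂]

/-- A smooth Riemannian metric on the open subset `U` of a vector space. -/
structure IsMetricOn (G : E → E →L[ℝ] E →L[ℝ] ℝ) (U : Set E) : Prop where
  isOpen : IsOpen U
  contDiffOn : ContDiffOn ℝ ∞ G U
  symm : ∀ y ∈ U, ∀ u v, G y u v = G y v u
  pos : ∀ y ∈ U, ∀ v, v ≠ 0 → 0 < G y v v

section Algebra

variable [FiniteDimensional ℝ E]

/-- A positive definite form, as an isomorphism from the space to its dual. -/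
theorem exists_equiv_of_posDef (B : E →L[ℝ] E →L[ℝ] ℝ) (hB : ∀ v, v ≠ 0 → 0 < B v v) :
    ∃ e : E ≃L[ℝ] (E →L[ℝ] ℝ), (e : E →L[ℝ] E →L[ℝ] ℝ) = B := by
  have hinj : Function.Injective B := by
    rw [injective_iff_map_eq_zero]
    intro v hv
    by_contra h
    have := hB v h
    rw [hv] at this
    simp at this
  have hfin : Module.finrank ℝ E = Module.finrank ℝ (E →L[ℝ] ℝ) := by
    rw [← (LinearMap.toContinuousLinearMap (𝕜 := ℝ) (E := E) (F' := ℝ)).finrank_eq]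
    exact (Subspace.dual_finrank_eq (K := ℝ) (V := E)).symm
  refine ⟨(LinearEquiv.ofInjectiveOfFinrankEq B.toLinearMap hinj hfin).toContinuousLinearEquiv, ?_⟩
  ext v w
  rfl

/-- Positive definiteness makes `B` invertible, so `inverse` is the true inverse and not its default
value `0`. -/
theorem apply_inverse_of_posDef {B : E →L[ℝ] E →L[ℝ] ℝ} (hB : ∀ v, v ≠ 0 → 0 < B v v)
    (a : E →L[ℝ] ℝ) : B (B.inverse a) = a := by
  obtain ⟨e, rfl⟩ := exists_equiv_of_posDef B hB
  simp

end Algebra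

theorem eq_of_posDef {B : E →L[ℝ] E →L[ℝ] ℝ} (hB : ∀ v, v ≠ 0 → 0 < B v v) {u v : E}
    (h : ∀ w, B u w = B v w) : u = v := by
  by_contra hne
  have := hB (u - v) (sub_ne_zero.2 hne)
  rw [map_sub (B (u - v)), map_sub B, sub_apply, sub_apply, h, h] at this
  simp at this

variable {G : E → E →L[ℝ] E →L[ℝ] ℝ} {U : Set E} {y : E}

theorem IsMetricOn.contDiffAt (hG : IsMetricOn G U) (hy : y ∈ U) : ContDiffAt ℝ ∞ G y :=
  hG.contDiffOn.contDiffAt (hG.isOpen.mem_nhds hy)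

theorem IsMetricOn.differentiableAt (hG : IsMetricOn G U) (hy : y ∈ U) :
    DifferentiableAt ℝ G y :=
  (hG.contDiffAt hy).differentiableAt (by simp)

theorem IsMetricOn.mono (hG : IsMetricOn G U) {V : Set E} (hV : IsOpen V) (hVU : V ⊆ U) :
    IsMetricOn G V :=
  ⟨hV, hG.contDiffOn.mono hVU, fun y hy => hG.symm y (hVU hy), fun y hy => hG.pos y (hVU hy)⟩

theorem contDiffAt_fderiv_top {f : E₁ → E₂} {y : E₁} (hf : ContDiffAt ℝ ∞ f y) :
    ContDiffAt ℝ ∞ (fderiv ℝ f) y :=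
  hf.fderiv_right (m := ∞) (by simp)

theorem differentiableAt_of_contDiffAt_top {f : E₁ → E₂} {y : E₁} (hf : ContDiffAt ℝ ∞ f y) :
    DifferentiableAt ℝ f y :=
  hf.differentiableAt (by simp)

theorem fderiv_clm_apply_const {c : E → E₁ →L[ℝ] E₂} (hc : DifferentiableAt ℝ c y) (v : E₁)
    (u : E) : fderiv ℝ (fun z => c z v) y u = fderiv ℝ c y u v := by
  rw [fderiv_clm_apply hc (differentiableAt_const v)]
  simp

theorem fderiv_fderiv_symm {f : E₁ → E₂} {y : E₁} (hf : ContDiffAt ℝ ∞ f y) (u v : E₁) :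
    fderiv ℝ (fderiv ℝ f) y u v = fderiv ℝ (fderiv ℝ f) y v u :=
  (hf.isSymmSndFDerivAt (by
    simpa using WithTop.coe_le_coe.2 (le_top : (2 : ℕ∞) ≤ ⊤))).eq u v

/-- The Christoffel form of the first kind, with values in the dual space. -/
noncomputable def christoffelForm (D : E →L[ℝ] E →L[ℝ] E →L[ℝ] ℝ) : E →L[ℝ] E →L[ℝ] E →L[ℝ] ℝ :=
  (1 / 2 : ℝ) • (D + D.flip
    - (ContinuousLinearMap.flipₗᵢ ℝ E E ℝ : _ →L[ℝ] (E →L[ℝ] E →L[ℝ] ℝ)).comp D.flip)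

theorem christoffelForm_apply (D : E →L[ℝ] E →L[ℝ] E →L[ℝ] ℝ) (u v w : E) :
    christoffelForm D u v w = (1 / 2) * (D u v w + D v u w - D w u v) := by
  simp [christoffelForm]

/-- The Christoffel map as a bundled bilinear map. -/
noncomputable def bilinChristoffel (G : E → E →L[ℝ] E →L[ℝ] ℝ) (y : E) : E →L[ℝ] E →L[ℝ] E :=
  (ContinuousLinearMap.postcomp E (G y).inverse).comp (christoffelForm (fderiv ℝ G y))

/-- Passing to a bundled map allows `Γ` to be differentiated once as a whole, instead of once for
each pair of vectors. -/
theorem christoffel_eq (hG : DifferentiableAt ℝ G y) (u v : E) :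
    christoffel G y u v = bilinChristoffel G y u v := by
  simp only [christoffel, bilinChristoffel, ContinuousLinearMap.comp_apply,
    ContinuousLinearMap.postcomp_apply]
  congr 1
  ext w
  rw [christoffelForm_apply]
  simp only [smul_apply, sub_apply, add_apply, smul_eq_mul]
  rw [fderiv_clm_apply_const hG, fderiv_clm_apply_const hG,
    fderiv_clm_apply_const (hG.clm_apply (differentiableAt_const u)), fderiv_clm_apply_const hG]

theorem IsMetricOn.fderiv_symm (hG : IsMetricOn G U) (hy : y ∈ U) (u v w : E) :
    fderiv ℝ G y u v w = fderiv ℝ G y u w v := by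
  have h := hG.differentiableAt hy
  have e : (fun z => G z v w) =ᶠ[𝓝 y] fun z => G z w v := by
    filter_upwards [hG.isOpen.mem_nhds hy] with z hz using hG.symm z hz v w
  have := DFunLike.congr_fun (e.fderiv_eq (𝕜 := ℝ)) u
  rwa [fderiv_clm_apply_const (h.clm_apply (differentiableAt_const v)), fderiv_clm_apply_const h,
    fderiv_clm_apply_const (h.clm_apply (differentiableAt_const w)),
    fderiv_clm_apply_const h] at this

section

variable [FiniteDimensional ℝ E]

theorem IsMetricOn.contDiffAt_inverse (hG : IsMetricOn G U)
    (hy : y ∈ U) : ContDiffAt ℝ ∞ (fun z => (G z).inverse) y := by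
  obtain ⟨e, he⟩ := exists_equiv_of_posDef (G y) (hG.pos y hy)
  have : CompleteSpace E := FiniteDimensional.complete ℝ E
  have h := contDiffAt_map_inverse (𝕜 := ℝ) (n := ∞) e
  rw [he] at h
  exact h.comp y (hG.contDiffAt hy)

theorem IsMetricOn.contDiffAt_bilinChristoffel (hG : IsMetricOn G U) (hy : y ∈ U) :
    ContDiffAt ℝ ∞ (bilinChristoffel G) y := by
  have hd := contDiffAt_fderiv_top (hG.contDiffAt hy)
  have hform : ContDiffAt ℝ ∞ (fun z => christoffelForm (fderiv ℝ G z)) y := by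
    have h1 : ContDiffAt ℝ ∞ (fun z => (fderiv ℝ G z).flip) y :=
      (ContinuousLinearMap.flipₗᵢ ℝ E E (E →L[ℝ] ℝ)).contDiff.contDiffAt.comp y hd
    exact ((hd.add h1).sub (contDiffAt_const.clm_comp h1)).const_smul _
  exact ((ContinuousLinearMap.compL ℝ E (E →L[ℝ] ℝ) E).contDiff.contDiffAt.comp y
    (hG.contDiffAt_inverse hy)).clm_comp
    hform

/-- The Koszul formula for constant fields. Later identities are tested against the metric through
this formula, so the inverse of `G` need not be expanded. -/
theorem IsMetricOn.apply_bilinChristoffel (hG : IsMetricOn G U) (hy : y ∈ U) (u v w : E) :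
    G y (bilinChristoffel G y u v) w =
      (1 / 2) * (fderiv ℝ G y u v w + fderiv ℝ G y v u w - fderiv ℝ G y w u v) := by
  simp only [bilinChristoffel, ContinuousLinearMap.comp_apply, ContinuousLinearMap.postcomp_apply]
  rw [apply_inverse_of_posDef (hG.pos y hy), christoffelForm_apply]

/-- Torsion-freeness: the right side of the Koszul formula is symmetric in `u, v` because `G` is
symmetric. -/
theorem IsMetricOn.bilinChristoffel_symm (hG : IsMetricOn G U) (hy : y ∈ U) (u v : E) :
    bilinChristoffel G y u v = bilinChristoffel G y v u := by
  refine eq_of_posDef (hG.pos y hy) fun w => ?_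
  rw [hG.apply_bilinChristoffel hy, hG.apply_bilinChristoffel hy, hG.fderiv_symm hy w u v]
  ring

/-- The Levi-Civita connection is compatible with the metric. -/
theorem IsMetricOn.fderiv_apply (hG : IsMetricOn G U) (hy : y ∈ U) (u v w : E) :
    fderiv ℝ G y u v w =
      G y (bilinChristoffel G y u v) w + G y v (bilinChristoffel G y u w) := by
  rw [hG.symm y hy v, hG.apply_bilinChristoffel hy, hG.apply_bilinChristoffel hy,
    hG.fderiv_symm hy u w v, hG.fderiv_symm hy v u w, hG.fderiv_symm hy w u v]
  ring

end

/-- The curvature of the connection with Christoffel map `Γ`. -/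
noncomputable def connCurvature (Γ : E → E →L[ℝ] E →L[ℝ] E) (y u v w : E) : E :=
  fderiv ℝ Γ y u v w - fderiv ℝ Γ y v u w + Γ y u (Γ y v w) - Γ y v (Γ y u w)

theorem fderiv_clm_apply_const₂ {Γ : E → E₁ →L[ℝ] E₁ →L[ℝ] E₂} (hΓ : DifferentiableAt ℝ Γ y)
    (u : E) (v w : E₁) : fderiv ℝ (fun z => Γ z v w) y u = fderiv ℝ Γ y u v w := by
  rw [fderiv_clm_apply_const (hΓ.clm_apply (differentiableAt_const v)),
    fderiv_clm_apply_const hΓ]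

theorem IsMetricOn.curvature_eq [FiniteDimensional ℝ E] (hG : IsMetricOn G U) (hy : y ∈ U)
    (u v w : E) : curvature G y u v w = connCurvature (bilinChristoffel G) y u v w := by
  have hΓ := differentiableAt_of_contDiffAt_top (hG.contDiffAt_bilinChristoffel hy)
  have e : ∀ v w, (fun z => christoffel G z v w) =ᶠ[𝓝 y] fun z => bilinChristoffel G z v w := by
    intro v w
    filter_upwards [hG.isOpen.mem_nhds hy] with z hz
      using christoffel_eq (hG.differentiableAt hz) v w
  simp only [curvature, connCurvature]
  rw [(e v w).fderiv_eq, (e u w).fderiv_eq, fderiv_clm_apply_const₂ hΓ,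
    fderiv_clm_apply_const₂ hΓ]
  simp only [christoffel_eq (hG.differentiableAt hy)]

/-- The curvature of a metric is skew-symmetric with respect to the metric. -/
theorem IsMetricOn.connCurvature_skew [FiniteDimensional ℝ E] (hG : IsMetricOn G U) (hy : y ∈ U)
    (u v w x : E) :
    G y (connCurvature (bilinChristoffel G) y u v w) x
      + G y w (connCurvature (bilinChristoffel G) y u v x) = 0 := by
  have hΓ := differentiableAt_of_contDiffAt_top (hG.contDiffAt_bilinChristoffel hy)
  have hd := hG.differentiableAt hy
  have hdd := differentiableAt_of_contDiffAt_top (contDiffAt_fderiv_top (hG.contDiffAt hy))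
  -- Differentiate metric compatibility once more. The second derivative of `G` is symmetric in `u,
  -- v`; skew-symmetrizing leaves exactly the curvature terms.
  have key : ∀ u v, fderiv ℝ (fderiv ℝ G) y u v w x =
      fderiv ℝ G y u (bilinChristoffel G y v w) x + G y (fderiv ℝ (bilinChristoffel G) y u v w) x
      + (fderiv ℝ G y u w (bilinChristoffel G y v x)
        + G y w (fderiv ℝ (bilinChristoffel G) y u v x)) := by
    intro u v
    have e : (fun z => fderiv ℝ G z v w x) =ᶠ[𝓝 y] fun z =>
        G z (bilinChristoffel G z v w) x + G z w (bilinChristoffel G z v x) := by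
      filter_upwards [hG.isOpen.mem_nhds hy] with z hz using hG.fderiv_apply hz v w x
    have h := DFunLike.congr_fun (e.fderiv_eq (𝕜 := ℝ)) u
    have c := fun (v : E) => differentiableAt_const (𝕜 := ℝ) (x := y) v
    have hΓw := (hΓ.clm_apply (c v)).clm_apply (c w)
    have hΓx := (hΓ.clm_apply (c v)).clm_apply (c x)
    rw [fderiv_clm_apply_const ((hdd.clm_apply (c v)).clm_apply (c w)),
      fderiv_clm_apply_const (hdd.clm_apply (c v)), fderiv_clm_apply_const hdd,
      fderiv_fun_add ((hd.clm_apply hΓw).clm_apply (c x)) ((hd.clm_apply (c w)).clm_apply hΓx),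
      fderiv_clm_apply (hd.clm_apply hΓw) (c x), fderiv_clm_apply hd hΓw,
      fderiv_clm_apply (hd.clm_apply (c w)) hΓx, fderiv_clm_apply hd (c w)] at h
    simp only [add_apply, ContinuousLinearMap.comp_apply, ContinuousLinearMap.flip_apply,
      fderiv_clm_apply_const₂ hΓ, fderiv_fun_const, Pi.zero_apply, zero_apply, map_zero,
      zero_add] at h
    rw [h]
    ring
  have hs := congrArg (fun T : E →L[ℝ] E →L[ℝ] ℝ => T w x)
    (fderiv_fderiv_symm (hG.contDiffAt hy) u v)
  simp only [key, hG.fderiv_apply hy] at hs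
  simp only [connCurvature, map_add, map_sub, add_apply, sub_apply]
  linarith

/-- The Koszul formula shows that an isometric map carries the Levi-Civita connection to the
tangential part of the Levi-Civita connection. -/
theorem christoffel_of_isometric [FiniteDimensional ℝ E₁] [FiniteDimensional ℝ E₂]
    {G₁ : E₁ → E₁ →L[ℝ] E₁ →L[ℝ] ℝ} {G₂ : E₂ → E₂ →L[ℝ] E₂ →L[ℝ] ℝ} {U₁ : Set E₁} {U₂ : Set E₂}
    (h₁ : IsMetricOn G₁ U₁) (h₂ : IsMetricOn G₂ U₂) {φ : E₁ → E₂} {y : E₁} (hy : y ∈ U₁)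
    (hφy : φ y ∈ U₂) (hφ : ContDiffAt ℝ ∞ φ y)
    (hiso : ∀ᶠ z in 𝓝 y, ∀ u v, G₁ z u v = G₂ (φ z) (fderiv ℝ φ z u) (fderiv ℝ φ z v))
    (u v w : E₁) :
    G₂ (φ y) (fderiv ℝ φ y (bilinChristoffel G₁ y u v)) (fderiv ℝ φ y w) =
      G₂ (φ y) (fderiv ℝ (fderiv ℝ φ) y u v
        + bilinChristoffel G₂ (φ y) (fderiv ℝ φ y u) (fderiv ℝ φ y v)) (fderiv ℝ φ y w) := by
  have hd := differentiableAt_of_contDiffAt_top hφ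
  have hdd := differentiableAt_of_contDiffAt_top (contDiffAt_fderiv_top hφ)
  have h1d := h₁.differentiableAt hy
  have h2d := h₂.differentiableAt hφy
  have c := fun (v : E₁) => differentiableAt_const (𝕜 := ℝ) (x := y) v
  -- The derivative of the isometry condition: one term from `G₂` and two from the second derivative
  -- of `φ`.
  have key : ∀ u v w, fderiv ℝ G₁ y u v w =
      fderiv ℝ G₂ (φ y) (fderiv ℝ φ y u) (fderiv ℝ φ y v) (fderiv ℝ φ y w)
      + G₂ (φ y) (fderiv ℝ (fderiv ℝ φ) y u v) (fderiv ℝ φ y w)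
      + G₂ (φ y) (fderiv ℝ φ y v) (fderiv ℝ (fderiv ℝ φ) y u w) := by
    intro u v w
    have e : (fun z => G₁ z v w) =ᶠ[𝓝 y]
        fun z => (G₂ ∘ φ) z (fderiv ℝ φ z v) (fderiv ℝ φ z w) := by
      filter_upwards [hiso] with z hz using hz v w
    have h := DFunLike.congr_fun (e.fderiv_eq (𝕜 := ℝ)) u
    have hc : DifferentiableAt ℝ (G₂ ∘ φ) y := h2d.comp y hd
    rw [fderiv_clm_apply_const₂ h1d,
      fderiv_clm_apply (hc.clm_apply (hdd.clm_apply (c v))) (hdd.clm_apply (c w)),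
      fderiv_clm_apply hc (hdd.clm_apply (c v))] at h
    simp only [add_apply, ContinuousLinearMap.comp_apply, ContinuousLinearMap.flip_apply,
      fderiv_clm_apply_const hdd, fderiv_comp y h2d hd, Function.comp] at h
    rw [h]
    ring
  have hk := h₁.apply_bilinChristoffel hy u v w
  have hi := hiso.self_of_nhds
  -- In the Koszul combination the second derivatives of `φ` cancel by symmetry, except for those in
  -- the directions `u, v`.
  rw [← hi, hk, key, key, key, map_add, add_apply, h₂.apply_bilinChristoffel hφy,
    fderiv_fderiv_symm hφ w u, fderiv_fderiv_symm hφ v u, fderiv_fderiv_symm hφ w v,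
    h₂.symm _ hφy (fderiv ℝ φ y v), h₂.symm _ hφy (fderiv ℝ φ y u)]
  ring

/-- A map `φ` is affine at `y` with respect to the connections `Γ₁`, `Γ₂` if it preserves them. -/
def IsAffineAt (Γ₁ : E₁ → E₁ →L[ℝ] E₁ →L[ℝ] E₁) (Γ₂ : E₂ → E₂ →L[ℝ] E₂ →L[ℝ] E₂)
    (φ : E₁ → E₂) (y : E₁) : Prop :=
  ∀ u v, fderiv ℝ φ y (Γ₁ y u v) =
    fderiv ℝ (fderiv ℝ φ) y u v + Γ₂ (φ y) (fderiv ℝ φ y u) (fderiv ℝ φ y v)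

/-- Affine maps preserve the curvature. -/
theorem IsAffineAt.map_connCurvature {Γ₁ : E₁ → E₁ →L[ℝ] E₁ →L[ℝ] E₁}
    {Γ₂ : E₂ → E₂ →L[ℝ] E₂ →L[ℝ] E₂} {φ : E₁ → E₂} {y : E₁} (hφ : ContDiffAt ℝ ∞ φ y)
    (hΓ₁ : DifferentiableAt ℝ Γ₁ y) (hΓ₂ : DifferentiableAt ℝ Γ₂ (φ y))
    (h : ∀ᶠ z in 𝓝 y, IsAffineAt Γ₁ Γ₂ φ z) (u v w : E₁) :
    fderiv ℝ φ y (connCurvature Γ₁ y u v w) =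
      connCurvature Γ₂ (φ y) (fderiv ℝ φ y u) (fderiv ℝ φ y v) (fderiv ℝ φ y w) := by
  have hd := differentiableAt_of_contDiffAt_top hφ
  have hφ' := contDiffAt_fderiv_top hφ
  have hdd := differentiableAt_of_contDiffAt_top hφ'
  have hddd := differentiableAt_of_contDiffAt_top (contDiffAt_fderiv_top hφ')
  have c := fun (v : E₁) => differentiableAt_const (𝕜 := ℝ) (x := y) v
  -- The derivative of the affine identity. After skew-symmetrizing in `u, v` the third derivatives
  -- of `φ` cancel, and the remaining second derivatives are rewritten by the affine identity itself
  -- (`h4`, `h5`).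
  have key : ∀ u v, fderiv ℝ (fderiv ℝ φ) y u (Γ₁ y v w) + fderiv ℝ φ y (fderiv ℝ Γ₁ y u v w) =
      fderiv ℝ (fderiv ℝ (fderiv ℝ φ)) y u v w
      + (fderiv ℝ Γ₂ (φ y) (fderiv ℝ φ y u) (fderiv ℝ φ y v) (fderiv ℝ φ y w)
      + Γ₂ (φ y) (fderiv ℝ (fderiv ℝ φ) y u v) (fderiv ℝ φ y w)
      + Γ₂ (φ y) (fderiv ℝ φ y v) (fderiv ℝ (fderiv ℝ φ) y u w)) := by
    intro u v
    have e : (fun z => fderiv ℝ φ z (Γ₁ z v w)) =ᶠ[𝓝 y] fun z => fderiv ℝ (fderiv ℝ φ) z v w +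
        (Γ₂ ∘ φ) z (fderiv ℝ φ z v) (fderiv ℝ φ z w) := by
      filter_upwards [h] with z hz using hz v w
    have h := DFunLike.congr_fun (e.fderiv_eq (𝕜 := ℝ)) u
    have hc : DifferentiableAt ℝ (Γ₂ ∘ φ) y := hΓ₂.comp y hd
    rw [fderiv_clm_apply hdd ((hΓ₁.clm_apply (c v)).clm_apply (c w)),
      fderiv_fun_add ((hddd.clm_apply (c v)).clm_apply (c w))
        ((hc.clm_apply (hdd.clm_apply (c v))).clm_apply (hdd.clm_apply (c w))),
      fderiv_clm_apply (hc.clm_apply (hdd.clm_apply (c v))) (hdd.clm_apply (c w)),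
      fderiv_clm_apply hc (hdd.clm_apply (c v))] at h
    simp only [add_apply, ContinuousLinearMap.comp_apply, ContinuousLinearMap.flip_apply,
      fderiv_clm_apply_const hdd, fderiv_clm_apply_const₂ hddd, fderiv_clm_apply_const₂ hΓ₁,
      fderiv_comp y hΓ₂ hd, Function.comp] at h
    rw [add_comm, h]
    abel
  have hself := h.self_of_nhds
  have k1 := key u v
  have k2 := key v u
  have h3 := congrArg (fun T : E₁ →L[ℝ] E₂ => T w) (fderiv_fderiv_symm hφ' u v)
  have h4 := hself u (Γ₁ y v w)
  have h5 := hself v (Γ₁ y u w)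
  rw [hself v w] at h4
  rw [hself u w] at h5
  rw [map_add] at h4 h5
  rw [fderiv_fderiv_symm hφ v u, ← h3] at k2
  simp only [connCurvature, map_add, map_sub]
  rw [h4, h5, eq_sub_of_add_eq' k1, eq_sub_of_add_eq' k2]
  abel

end LocalTheory

/-! ### Riemannian submersions and their fibers in coordinates. -/

section LocalSubmersion

variable {E : Type*} [NormedAddCommGroup E] [NormedSpace ℝ E]
  {E' : Type*} [NormedAddCommGroup E'] [NormedSpace ℝ E']
  {F : Type*} [NormedAddCommGroup F] [NormedSpace ℝ F]

/-- A Riemannian submersion between open subsets of vector spaces. -/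
structure IsSubmersionOn (G : E → E →L[ℝ] E →L[ℝ] ℝ) (U : Set E)
    (G' : E' → E' →L[ℝ] E' →L[ℝ] ℝ) (U' : Set E') (f : E → E') : Prop where
  metric : IsMetricOn G U
  metric' : IsMetricOn G' U'
  mapsTo : Set.MapsTo f U U'
  contDiffOn : ContDiffOn ℝ ∞ f U
  surjective : ∀ y ∈ U, Function.Surjective (fderiv ℝ f y)
  isometry : ∀ y ∈ U, ∀ u, (∀ w, fderiv ℝ f y w = 0 → G y u w = 0) →
    G' (f y) (fderiv ℝ f y u) (fderiv ℝ f y u) = G y u u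

/-- Orthogonal decomposition with respect to a subspace. -/
theorem exists_orthogonal_decomposition [FiniteDimensional ℝ E] {B : E →L[ℝ] E →L[ℝ] ℝ}
    (hB : ∀ v, v ≠ 0 → 0 < B v v) (W : Submodule ℝ E) (u : E) :
    ∃ w ∈ W, ∀ x ∈ W, B (u - w) x = 0 := by
  have hW : ∀ v : W, v ≠ 0 → 0 < (B.bilinearComp W.subtypeL W.subtypeL) v v :=
    fun v hv => hB v (by simpa using hv)
  -- The component in `W` is the vector that represents the functional `B u` on `W` with respect to
  -- the restricted form.
  refine ⟨((B.bilinearComp W.subtypeL W.subtypeL).inverse ((B u).comp W.subtypeL) : W),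
    Subtype.prop _, fun x hx => ?_⟩
  have h := DFunLike.congr_fun (apply_inverse_of_posDef hW ((B u).comp W.subtypeL)) ⟨x, hx⟩
  simp only [ContinuousLinearMap.bilinearComp_apply, ContinuousLinearMap.comp_apply,
    Submodule.subtypeL_apply] at h
  rw [map_sub, sub_apply, h, sub_self]

/-- The projection onto the horizontal space of a Riemannian submersion `f`: the pull-back of `G'`
along `f`, with an index raised by `G`. -/
noncomputable def horizontalProj (G : E → E →L[ℝ] E →L[ℝ] ℝ) (G' : E' → E' →L[ℝ] E' →L[ℝ] ℝ) (f : E → E')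
    (y : E) : E →L[ℝ] E :=
  (G y).inverse.comp ((ContinuousLinearMap.precomp ℝ (fderiv ℝ f y)).comp
    ((G' (f y)).comp (fderiv ℝ f y)))

variable {G : E → E →L[ℝ] E →L[ℝ] ℝ} {U : Set E} {G' : E' → E' →L[ℝ] E' →L[ℝ] ℝ} {U' : Set E'}
  {f : E → E'} {y : E}

namespace IsSubmersionOn

theorem contDiffAt (h : IsSubmersionOn G U G' U' f) (hy : y ∈ U) : ContDiffAt ℝ ∞ f y :=
  h.contDiffOn.contDiffAt (h.metric.isOpen.mem_nhds hy)

theorem horizontalProj_of_vertical {u : E} (hu : fderiv ℝ f y u = 0) :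
    horizontalProj G G' f y u = 0 := by
  simp [horizontalProj, hu]

variable [FiniteDimensional ℝ E]

theorem metric_horizontalProj (h : IsSubmersionOn G U G' U' f) (hy : y ∈ U) (u v : E) :
    G y (horizontalProj G G' f y u) v = G' (f y) (fderiv ℝ f y u) (fderiv ℝ f y v) := by
  simp [horizontalProj, apply_inverse_of_posDef (h.metric.pos y hy)]

/-- The formula through `inverse` makes smoothness visible, which an orthogonal projection chosen
point by point would not. -/
theorem contDiffAt_horizontalProj (h : IsSubmersionOn G U G' U' f) (hy : y ∈ U) :
    ContDiffAt ℝ ∞ (horizontalProj G G' f) y := by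
  have hd := contDiffAt_fderiv_top (h.contDiffAt hy)
  have hpre : ContDiffAt ℝ ∞ (fun L : E →L[ℝ] E' => ContinuousLinearMap.precomp ℝ L)
      (fderiv ℝ f y) := (ContinuousLinearMap.compL ℝ E E' ℝ).flip.contDiff.contDiffAt
  exact (h.metric.contDiffAt_inverse hy).clm_comp ((hpre.comp y hd).clm_comp
    (((h.metric'.contDiffAt (h.mapsTo hy)).comp y (h.contDiffAt hy)).clm_comp hd))

/-- The isometry condition on horizontal vectors polarizes to inner products. So the pull-back of
`G'` agrees with `G` on horizontal vectors, and raising the index fixes them. Vertical vectors are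
killed, so `u` and its image under the projection differ by a vertical vector. -/
theorem fderiv_horizontalProj (h : IsSubmersionOn G U G' U' f) (hy : y ∈ U) (u : E) :
    fderiv ℝ f y (horizontalProj G G' f y u) = fderiv ℝ f y u := by
  have dec : ∀ u, ∃ w, fderiv ℝ f y w = 0 ∧ ∀ x, fderiv ℝ f y x = 0 → G y (u - w) x = 0 :=
    exists_orthogonal_decomposition (h.metric.pos y hy) (fderiv ℝ f y).ker
  have polar : ∀ a b, (∀ x, fderiv ℝ f y x = 0 → G y a x = 0) →
      (∀ x, fderiv ℝ f y x = 0 → G y b x = 0) →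
      G' (f y) (fderiv ℝ f y a) (fderiv ℝ f y b) = G y a b := by
    intro a b ha hb
    have h1 := h.isometry y hy (a + b) fun x hx => by rw [map_add, add_apply, ha x hx, hb x hx,
      add_zero]
    simp only [map_add, add_apply] at h1
    rw [h.isometry y hy a ha, h.isometry y hy b hb, h.metric'.symm _ (h.mapsTo hy)
      (fderiv ℝ f y b), h.metric.symm y hy b a] at h1
    linarith
  obtain ⟨w, hw, hor⟩ := dec u
  have hfix : horizontalProj G G' f y (u - w) = u - w := by
    refine eq_of_posDef (h.metric.pos y hy) fun v => ?_
    obtain ⟨w', hw', hor'⟩ := dec v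
    have h1 := polar _ _ hor hor'
    rw [map_sub _ v w', map_sub _ v w', hor w' hw', hw', sub_zero, sub_zero] at h1
    rw [h.metric_horizontalProj hy, h1]
  have hw0 := horizontalProj_of_vertical (G := G) (G' := G') hw
  rw [map_sub, hw0, sub_zero] at hfix
  rw [hfix, map_sub, hw, sub_zero]

/-- If the Hessian of a Riemannian submersion vanishes on vertical vectors, i.e. if the vertical
distribution is parallel, then the submersion is an affine map. -/
theorem isAffineAt [FiniteDimensional ℝ E'] (h : IsSubmersionOn G U G' U' f)
    (hvert : ∀ y ∈ U, ∀ u w, fderiv ℝ f y w = 0 →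
      fderiv ℝ (fderiv ℝ f) y u w = fderiv ℝ f y (bilinChristoffel G y u w)) (hy : y ∈ U) :
    IsAffineAt (bilinChristoffel G) (bilinChristoffel G') f y := by
  have hfy := h.contDiffAt hy
  have hd := differentiableAt_of_contDiffAt_top hfy
  have hdd := differentiableAt_of_contDiffAt_top (contDiffAt_fderiv_top hfy)
  have hH := differentiableAt_of_contDiffAt_top (h.contDiffAt_horizontalProj hy)
  have hGd := h.metric.differentiableAt hy
  have hGd' := h.metric'.differentiableAt (h.mapsTo hy)
  have c := fun (v : E) => differentiableAt_const (𝕜 := ℝ) (x := y) v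
  have hU := h.metric.isOpen.mem_nhds hy
  set H := horizontalProj G G' f with hHdef
  have hgHH : ∀ z ∈ U, ∀ u v, G z u (H z v) = G' (f z) (fderiv ℝ f z u) (fderiv ℝ f z v) := by
    intro z hz u v
    rw [h.metric.symm z hz, h.metric_horizontalProj hz, h.metric'.symm _ (h.mapsTo hz)]
  -- Differentiate `df (H u) = df u` and use the hypothesis on the vertical vector `u - H u`: the
  -- covariant derivative of `H` has vertical values.
  have hcov : ∀ w u, fderiv ℝ f y (fderiv ℝ H y w u + bilinChristoffel G y w (H y u)) =
      fderiv ℝ f y (bilinChristoffel G y w u) := by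
    intro w u
    have e : (fun z => fderiv ℝ f z (H z u)) =ᶠ[𝓝 y] fun z => fderiv ℝ f z u := by
      filter_upwards [hU] with z hz using h.fderiv_horizontalProj hz u
    have h1 := DFunLike.congr_fun (e.fderiv_eq (𝕜 := ℝ)) w
    rw [fderiv_clm_apply hdd (hH.clm_apply (c u)), fderiv_clm_apply_const hdd] at h1
    simp only [add_apply, ContinuousLinearMap.comp_apply, ContinuousLinearMap.flip_apply,
      fderiv_clm_apply_const hH] at h1
    have h2 := hvert y hy w (u - H y u) (by rw [map_sub, h.fderiv_horizontalProj hy, sub_self])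
    simp only [map_sub] at h2
    rw [map_add, eq_sub_of_add_eq h1, h2]
    abel
  set C : E → E → E' := fun u v => fderiv ℝ (fderiv ℝ f) y u v
    + bilinChristoffel G' (f y) (fderiv ℝ f y u) (fderiv ℝ f y v)
    - fderiv ℝ f y (bilinChristoffel G y u v) with hC
  have hCs : ∀ u v, C u v = C v u := by
    intro u v
    simp only [hC]
    rw [fderiv_fderiv_symm hfy u v, h.metric.bilinChristoffel_symm hy u v,
      h.metric'.bilinChristoffel_symm (h.mapsTo hy)]
  -- Differentiate `G'(df u, df v) = G(H u, H v)`; compatibility of both connections and `hcov` turn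
  -- the result into skewness of `C`.
  have hskew : ∀ w u v, G' (f y) (C w u) (fderiv ℝ f y v)
      + G' (f y) (C w v) (fderiv ℝ f y u) = 0 := by
    intro w u v
    have e : (fun z => (G' ∘ f) z (fderiv ℝ f z u) (fderiv ℝ f z v)) =ᶠ[𝓝 y]
        fun z => G z (H z u) (H z v) := by
      filter_upwards [hU] with z hz
      rw [h.metric_horizontalProj hz, h.fderiv_horizontalProj hz]
      rfl
    have h1 := DFunLike.congr_fun (e.fderiv_eq (𝕜 := ℝ)) w
    have hc : DifferentiableAt ℝ (G' ∘ f) y := hGd'.comp y hd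
    have hHc := fun v : E => hH.clm_apply (c v)
    rw [fderiv_clm_apply (hc.clm_apply (hdd.clm_apply (c u))) (hdd.clm_apply (c v)),
      fderiv_clm_apply hc (hdd.clm_apply (c u)), fderiv_clm_apply (hGd.clm_apply (hHc u)) (hHc v),
      fderiv_clm_apply hGd (hHc u)] at h1
    simp only [add_apply, ContinuousLinearMap.comp_apply, ContinuousLinearMap.flip_apply,
      fderiv_clm_apply_const hdd, fderiv_clm_apply_const hH, fderiv_comp y hGd' hd,
      Function.comp, h.metric'.fderiv_apply (h.mapsTo hy), h.metric.fderiv_apply hy] at h1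
    have h2 := fun w u v => (hgHH y hy (fderiv ℝ H y w u + bilinChristoffel G y w (H y u)) v).trans
      (by rw [hcov])
    have h3 := h2 w u v
    have h4 := h2 w v u
    simp only [map_add, add_apply] at h3 h4
    simp only [hC, map_add, map_sub, add_apply, sub_apply]
    rw [h.metric.symm y hy (H y u), h.metric.symm y hy (H y u),
      h.metric'.symm _ (h.mapsTo hy) (fderiv ℝ f y u),
      h.metric'.symm _ (h.mapsTo hy) (fderiv ℝ f y u)] at h1
    linarith
  -- Symmetric in the first two slots and skew in the last two: three cyclic instances force zero.
  have hzero : ∀ w u v, G' (f y) (C w u) (fderiv ℝ f y v) = 0 := by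
    intro w u v
    have e1 := hskew w u v
    have e2 := hskew v w u
    have e3 := hskew u v w
    rw [hCs v w] at e2
    rw [hCs u v, hCs u w] at e3
    linarith
  intro u v
  obtain ⟨x, hx⟩ := h.surjective y hy (C u v)
  have hC0 : C u v = 0 := by
    by_contra hne
    have := h.metric'.pos _ (h.mapsTo hy) _ hne
    nth_rewrite 2 [← hx] at this
    rw [hzero] at this
    exact this.false
  exact (sub_eq_zero.1 hC0).symm

end IsSubmersionOn

/-- The fiber of a Riemannian submersion `f` between open subsets of vector spaces, parametrized
by `i`, with the induced metric. -/
structure IsFiberOn (G : E → E →L[ℝ] E →L[ℝ] ℝ) (U : Set E) (f : E → E')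
    (GF : F → F →L[ℝ] F →L[ℝ] ℝ) (UF : Set F) (i : F → E) : Prop where
  metric : IsMetricOn GF UF
  mapsTo : Set.MapsTo i UF U
  contDiffOn : ContDiffOn ℝ ∞ i UF
  isometric : ∀ z ∈ UF, ∀ u v, GF z u v = G (i z) (fderiv ℝ i z u) (fderiv ℝ i z v)
  const : ∃ c, ∀ z ∈ UF, f (i z) = c
  exists_eq : ∀ z ∈ UF, ∀ x, fderiv ℝ f (i z) x = 0 → ∃ v, fderiv ℝ i z v = x

namespace IsFiberOn

variable {GF : F → F →L[ℝ] F →L[ℝ] ℝ} {UF : Set F} {i : F → E} {z : F}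

theorem contDiffAt (hi : IsFiberOn G U f GF UF i) (hz : z ∈ UF) : ContDiffAt ℝ ∞ i z :=
  hi.contDiffOn.contDiffAt (hi.metric.isOpen.mem_nhds hz)

theorem fderiv_fderiv_eq_zero (h : IsSubmersionOn G U G' U' f) (hi : IsFiberOn G U f GF UF i)
    (hz : z ∈ UF) (u : F) : fderiv ℝ f (i z) (fderiv ℝ i z u) = 0 := by
  obtain ⟨c, hc⟩ := hi.const
  have e : f ∘ i =ᶠ[𝓝 z] fun _ => c := by
    filter_upwards [hi.metric.isOpen.mem_nhds hz] with a ha using hc a ha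
  have h1 := DFunLike.congr_fun (e.fderiv_eq (𝕜 := ℝ)) u
  rw [fderiv_comp z (differentiableAt_of_contDiffAt_top (h.contDiffAt (hi.mapsTo hz)))
    (differentiableAt_of_contDiffAt_top (hi.contDiffAt hz))] at h1
  simpa using h1

/-- The fibers of a Riemannian submersion with parallel vertical distribution are totally
geodesic. -/
theorem isAffineAt [FiniteDimensional ℝ E] [FiniteDimensional ℝ F]
    (h : IsSubmersionOn G U G' U' f) (hi : IsFiberOn G U f GF UF i)
    (hvert : ∀ y ∈ U, ∀ u w, fderiv ℝ f y w = 0 →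
      fderiv ℝ (fderiv ℝ f) y u w = fderiv ℝ f y (bilinChristoffel G y u w)) (hz : z ∈ UF) :
    IsAffineAt (bilinChristoffel GF) (bilinChristoffel G) i z := by
  intro u v
  have hfy := h.contDiffAt (hi.mapsTo hz)
  have hiz := hi.contDiffAt hz
  have hd := differentiableAt_of_contDiffAt_top hfy
  have hdd := differentiableAt_of_contDiffAt_top (contDiffAt_fderiv_top hfy)
  have hid := differentiableAt_of_contDiffAt_top hiz
  have hidd := differentiableAt_of_contDiffAt_top (contDiffAt_fderiv_top hiz)
  have hU := hi.metric.isOpen.mem_nhds hz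
  have hk := christoffel_of_isometric hi.metric h.metric hz (hi.mapsTo hz) hiz
    (by filter_upwards [hU] with a ha using hi.isometric a ha) u v
  have e : (fun a => (fderiv ℝ f ∘ i) a (fderiv ℝ i a v)) =ᶠ[𝓝 z] fun _ => 0 := by
    filter_upwards [hU] with a ha using fderiv_fderiv_eq_zero h hi ha v
  have h1 := DFunLike.congr_fun (e.fderiv_eq (𝕜 := ℝ)) u
  rw [fderiv_clm_apply (hdd.comp z hid) (hidd.clm_apply (differentiableAt_const v)),
    fderiv_comp z hdd hid] at h1
  simp only [add_apply, ContinuousLinearMap.comp_apply, ContinuousLinearMap.flip_apply,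
    fderiv_clm_apply_const hidd, Function.comp, fderiv_fun_const, Pi.zero_apply,
    zero_apply] at h1
  have h2 := hvert _ (hi.mapsTo hz) (fderiv ℝ i z u) _ (fderiv_fderiv_eq_zero h hi hz v)
  -- The second fundamental form of the fiber is vertical, since the derivative of `df (di v) = 0`
  -- matches the vanishing Hessian. So it is tangent to the fiber, while `hk` says that it is
  -- normal.
  obtain ⟨x, hx⟩ := hi.exists_eq z hz (fderiv ℝ (fderiv ℝ i) z u v
    + bilinChristoffel G (i z) (fderiv ℝ i z u) (fderiv ℝ i z v)
    - fderiv ℝ i z (bilinChristoffel GF z u v)) (by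
      rw [map_sub, map_add, ← h2, h1, fderiv_fderiv_eq_zero h hi hz, sub_zero])
  by_contra hne
  have := h.metric.pos _ (hi.mapsTo hz) _ (sub_ne_zero.2 (Ne.symm hne))
  nth_rewrite 2 [← hx] at this
  rw [map_sub, sub_apply, hk x, sub_self] at this
  exact this.false

end IsFiberOn

end LocalSubmersion

/-! ### Ricci and scalar curvature as traces over the vertical and horizontal splitting. -/

section Traces

/-- The trace of an endomorphism, computed from a splitting of the space. -/
theorem trace_eq_add_of_splitting {E E' F : Type*} [AddCommGroup E] [Module ℝ E] [AddCommGroup E']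
    [Module ℝ E'] [AddCommGroup F] [Module ℝ F] [FiniteDimensional ℝ E] [FiniteDimensional ℝ E']
    [FiniteDimensional ℝ F] {ι : F →ₗ[ℝ] E} {p : E →ₗ[ℝ] F} {π : E →ₗ[ℝ] E'} {h : E' →ₗ[ℝ] E}
    (hsplit : ∀ x, ι (p x) + h (π x) = x) (A : E →ₗ[ℝ] E) :
    LinearMap.trace ℝ E A = LinearMap.trace ℝ F (p ∘ₗ A ∘ₗ ι) + LinearMap.trace ℝ E' (π ∘ₗ A ∘ₗ h)
    := by
  -- Cyclicity of the trace reduces the claim to `ι p + h π = id`; the other projection identities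
  -- are not needed.
  rw [LinearMap.trace_comp_comm' (A ∘ₗ ι) p, LinearMap.trace_comp_comm' (A ∘ₗ h) π, ← map_add]
  congr 1
  ext x
  simp only [LinearMap.add_apply, LinearMap.comp_apply]
  rw [← map_add, hsplit]

variable {E : Type*} [NormedAddCommGroup E] [NormedSpace ℝ E]
  {E' : Type*} [NormedAddCommGroup E'] [NormedSpace ℝ E']
  {F : Type*} [NormedAddCommGroup F] [NormedSpace ℝ F]

theorem sum_coord_eq_trace {V : Type*} [AddCommGroup V] [Module ℝ V] {n : Type*} [Fintype n]
    (b : Module.Basis n ℝ V) (A : V →ₗ[ℝ] V) :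
    ∑ i, b.coord i (A (b i)) = LinearMap.trace ℝ V A := by
  classical
  rw [LinearMap.trace_eq_matrix_trace ℝ b, Matrix.trace]
  simp [LinearMap.toMatrix_apply]

/-- The endomorphism `u ↦ R(u, v)w`. -/
noncomputable def curvatureEnd (Γ : E → E →L[ℝ] E →L[ℝ] E) (y v w : E) : E →ₗ[ℝ] E where
  toFun u := connCurvature Γ y u v w
  map_add' a b := by
    simp only [connCurvature, map_add, add_apply]
    abel
  map_smul' c a := by
    simp only [connCurvature, map_smul, smul_apply, RingHom.id_apply, smul_sub, smul_add]

theorem curvatureEnd_apply (Γ : E → E →L[ℝ] E →L[ℝ] E) (y u v w : E) :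
    curvatureEnd Γ y v w u = connCurvature Γ y u v w := rfl

/-- The Ricci form of a connection. -/
noncomputable def connRicci (Γ : E → E →L[ℝ] E →L[ℝ] E) (y : E) : E →ₗ[ℝ] E →ₗ[ℝ] ℝ :=
  LinearMap.mk₂ ℝ (fun v w => LinearMap.trace ℝ E (curvatureEnd Γ y v w))
    (fun a b w => by
      rw [← map_add]
      congr 1
      ext u
      simp only [LinearMap.add_apply, curvatureEnd_apply, connCurvature, map_add, add_apply]
      abel)
    (fun c a w => by
      rw [← map_smul]
      congr 1
      ext u
      simp only [LinearMap.smul_apply, curvatureEnd_apply, connCurvature, map_smul, smul_apply,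
        smul_sub, smul_add])
    (fun v a b => by
      rw [← map_add]
      congr 1
      ext u
      simp only [LinearMap.add_apply, curvatureEnd_apply, connCurvature, map_add]
      abel)
    (fun c v a => by
      rw [← map_smul]
      congr 1
      ext u
      simp only [LinearMap.smul_apply, curvatureEnd_apply, connCurvature, map_smul,
        smul_sub, smul_add])

theorem connRicci_apply (Γ : E → E →L[ℝ] E →L[ℝ] E) (y v w : E) :
    connRicci Γ y v w = LinearMap.trace ℝ E (curvatureEnd Γ y v w) := rfl

section

variable [FiniteDimensional ℝ E] {G : E → E →L[ℝ] E →L[ℝ] ℝ} {U : Set E} {y : E}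

theorem IsMetricOn.localRicci_eq (hG : IsMetricOn G U) (hy : y ∈ U) (v w : E) :
    localRicci G y v w = connRicci (bilinChristoffel G) y v w := by
  simp only [localRicci, hG.curvature_eq hy]
  rw [connRicci_apply, ← sum_coord_eq_trace (Module.finBasis ℝ E)]
  rfl

/-- The Ricci endomorphism: the Ricci form with an index raised by the metric. -/
noncomputable def ricciEnd (G : E → E →L[ℝ] E →L[ℝ] ℝ) (y : E) : E →ₗ[ℝ] E :=
  (G y).inverse.toLinearMap ∘ₗ LinearMap.toContinuousLinearMap.toLinearMap ∘ₗ
    connRicci (bilinChristoffel G) y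

theorem IsMetricOn.apply_ricciEnd (hG : IsMetricOn G U) (hy : y ∈ U) (v w : E) :
    G y (ricciEnd G y v) w = connRicci (bilinChristoffel G) y v w := by
  simp [ricciEnd, apply_inverse_of_posDef (hG.pos y hy)]

/-- The `i`-th diagonal coefficient of the Ricci endomorphism is its pairing under `G` with the
vector representing `b^i`. -/
theorem IsMetricOn.localScalar_eq (hG : IsMetricOn G U) (hy : y ∈ U) :
    localScalar G y = LinearMap.trace ℝ E (ricciEnd G y) := by
  rw [← sum_coord_eq_trace (Module.finBasis ℝ E), localScalar]
  refine Finset.sum_congr rfl fun j _ => ?_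
  rw [hG.localRicci_eq hy, ← hG.apply_ricciEnd hy, hG.symm y hy,
    apply_inverse_of_posDef (hG.pos y hy)]
  rfl

end

variable {G : E → E →L[ℝ] E →L[ℝ] ℝ} {U : Set E} {G' : E' → E' →L[ℝ] E' →L[ℝ] ℝ} {U' : Set E'}
  {f : E → E'} {GF : F → F →L[ℝ] F →L[ℝ] ℝ} {UF : Set F} {i : F → E} {z : F}

variable [FiniteDimensional ℝ E]

/-- The splitting of the tangent space at a point of a fiber. -/
theorem IsFiberOn.exists_splitting (h : IsSubmersionOn G U G' U' f) (hi : IsFiberOn G U f GF UF i)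
    (hz : z ∈ UF) : ∃ (p : E →ₗ[ℝ] F) (s : E' →ₗ[ℝ] E),
      (∀ x, p (fderiv ℝ i z x) = x) ∧ (∀ x, fderiv ℝ f (i z) (s x) = x) ∧
      (∀ x, fderiv ℝ i z (p x) + s (fderiv ℝ f (i z) x) = x) ∧
      (∀ a b, G (i z) (fderiv ℝ i z a) (s b) = 0) ∧
      ∀ a b, G (i z) (s a) (s b) = G' (f (i z)) a b := by
  have hy := hi.mapsTo hz
  obtain ⟨t, ht⟩ := (fderiv ℝ f (i z)).toLinearMap.exists_rightInverse_of_surjective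
    (LinearMap.range_eq_top.2 (h.surjective _ hy))
  have hinj : Function.Injective (fderiv ℝ i z) := by
    rw [injective_iff_map_eq_zero]
    intro v hv
    by_contra hne
    have := hi.metric.pos z hz v hne
    rw [hi.isometric z hz, hv] at this
    simp at this
  obtain ⟨r, hr⟩ := (fderiv ℝ i z).toLinearMap.exists_leftInverse_of_injective
    (LinearMap.ker_eq_bot.2 hinj)
  have ht' : ∀ x, fderiv ℝ f (i z) (t x) = x := fun x => DFunLike.congr_fun ht x
  have hr' : ∀ x, r (fderiv ℝ i z x) = x := fun x => DFunLike.congr_fun hr x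
  set H := horizontalProj G G' f (i z)
  have hHv : ∀ u, fderiv ℝ f (i z) u = 0 → H u = 0 :=
    fun u hu => IsSubmersionOn.horizontalProj_of_vertical hu
  have hfH : ∀ u, fderiv ℝ f (i z) (H u) = fderiv ℝ f (i z) u :=
    fun u => h.fderiv_horizontalProj hy u
  have hGH : ∀ u v, G (i z) (H u) v = G' (f (i z)) (fderiv ℝ f (i z) u) (fderiv ℝ f (i z) v) :=
    fun u v => h.metric_horizontalProj hy u v
  have hfi := fun u => IsFiberOn.fderiv_fderiv_eq_zero h hi hz u
  -- The section `s` is the horizontal lift, any linear right inverse `t` followed by `H`. The map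
  -- `p` removes the horizontal part and then inverts `di` by `r`.
  refine ⟨r ∘ₗ (LinearMap.id - H.toLinearMap), H.toLinearMap ∘ₗ t, fun x => ?_, fun x => ?_,
    fun x => ?_, fun a b => ?_, fun a b => ?_⟩
  · simp [hHv _ (hfi x), hr']
  · simp [hfH, ht']
  · have e : H (t (fderiv ℝ f (i z) x)) = H x := by
      rw [← sub_eq_zero, ← map_sub]
      exact hHv _ (by rw [map_sub, ht', sub_self])
    obtain ⟨v, hv⟩ := hi.exists_eq z hz (x - H x) (by rw [map_sub, hfH, sub_self])
    simp [e, ← hv, hr']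
    simp [hv]
  · simp only [LinearMap.comp_apply, ContinuousLinearMap.coe_coe]
    rw [h.metric.symm _ hy, hGH, hfi, map_zero]
  · simp only [LinearMap.comp_apply, ContinuousLinearMap.coe_coe]
    rw [hGH, hfH, ht', ht']

/-- The Hessian of `f` vanishes on vertical vectors. In the presence of a submersion metric this
says that the vertical distribution is parallel. -/
def IsVerticalParallelOn (G : E → E →L[ℝ] E →L[ℝ] ℝ) (U : Set E) (f : E → E') : Prop :=
  ∀ y ∈ U, ∀ u w, fderiv ℝ f y w = 0 →
    fderiv ℝ (fderiv ℝ f) y u w = fderiv ℝ f y (bilinChristoffel G y u w)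

theorem IsFiberOn.map_curvature_fiber [FiniteDimensional ℝ F] (h : IsSubmersionOn G U G' U' f)
    (hi : IsFiberOn G U f GF UF i) (hvert : IsVerticalParallelOn G U f) (hz : z ∈ UF)
    (u v w : F) :
    fderiv ℝ i z (connCurvature (bilinChristoffel GF) z u v w) =
      connCurvature (bilinChristoffel G) (i z) (fderiv ℝ i z u) (fderiv ℝ i z v)
        (fderiv ℝ i z w) := by
  have hy := hi.mapsTo hz
  refine IsAffineAt.map_connCurvature (hi.contDiffAt hz)
    (differentiableAt_of_contDiffAt_top (hi.metric.contDiffAt_bilinChristoffel hz))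
    (differentiableAt_of_contDiffAt_top (h.metric.contDiffAt_bilinChristoffel hy)) ?_ u v w
  filter_upwards [hi.metric.isOpen.mem_nhds hz] with a ha using hi.isAffineAt h hvert ha

section

variable [FiniteDimensional ℝ E'] (h : IsSubmersionOn G U G' U' f) (hi : IsFiberOn G U f GF UF i)
    (hvert : IsVerticalParallelOn G U f) (hz : z ∈ UF)

include h hi hvert hz

theorem IsFiberOn.map_curvature_submersion (u v w : E) :
    fderiv ℝ f (i z) (connCurvature (bilinChristoffel G) (i z) u v w) =
      connCurvature (bilinChristoffel G') (f (i z)) (fderiv ℝ f (i z) u) (fderiv ℝ f (i z) v)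
        (fderiv ℝ f (i z) w) := by
  have hy := hi.mapsTo hz
  refine IsAffineAt.map_connCurvature (h.contDiffAt hy)
    (differentiableAt_of_contDiffAt_top (h.metric.contDiffAt_bilinChristoffel hy))
    (differentiableAt_of_contDiffAt_top (h.metric'.contDiffAt_bilinChristoffel (h.mapsTo hy))) ?_
    u v w
  filter_upwards [h.metric.isOpen.mem_nhds hy] with a ha using h.isAffineAt hvert ha

variable [FiniteDimensional ℝ F]

/-- The vertical block of `u ↦ R(u, v)w` is the curvature of the fiber. In the horizontal block `df`
turns `R(u, v)w` into a base curvature with two zero arguments. -/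
theorem IsFiberOn.connRicci_fiber (v w : F) :
    connRicci (bilinChristoffel G) (i z) (fderiv ℝ i z v) (fderiv ℝ i z w) =
      connRicci (bilinChristoffel GF) z v w := by
  obtain ⟨p, s, hp, -, hsplit, -⟩ := hi.exists_splitting h hz
  simp only [connRicci_apply]
  rw [trace_eq_add_of_splitting (ι := (fderiv ℝ i z).toLinearMap)
    (π := (fderiv ℝ f (i z)).toLinearMap) hsplit]
  have e1 : p ∘ₗ curvatureEnd (bilinChristoffel G) (i z) (fderiv ℝ i z v) (fderiv ℝ i z w) ∘ₗ
      (fderiv ℝ i z).toLinearMap = curvatureEnd (bilinChristoffel GF) z v w := by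
    ext u
    simp only [LinearMap.comp_apply, curvatureEnd_apply, ContinuousLinearMap.coe_coe]
    rw [← hi.map_curvature_fiber h hvert hz, hp]
  have e2 : (fderiv ℝ f (i z)).toLinearMap ∘ₗ
      curvatureEnd (bilinChristoffel G) (i z) (fderiv ℝ i z v) (fderiv ℝ i z w) ∘ₗ s = 0 := by
    ext u
    simp only [LinearMap.comp_apply, curvatureEnd_apply, ContinuousLinearMap.coe_coe]
    rw [hi.map_curvature_submersion h hvert hz, IsFiberOn.fderiv_fderiv_eq_zero h hi hz,
      IsFiberOn.fderiv_fderiv_eq_zero h hi hz]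
    simp [connCurvature]
  rw [e1, e2, map_zero, add_zero]

/-- The Ricci form of a vertically parallel Riemannian submersion on horizontal vectors. -/
theorem IsFiberOn.connRicci_horizontal {p : E →ₗ[ℝ] F} {s : E' →ₗ[ℝ] E}
    (hs : ∀ x, fderiv ℝ f (i z) (s x) = x)
    (hsplit : ∀ x, fderiv ℝ i z (p x) + s (fderiv ℝ f (i z) x) = x)
    (horth : ∀ a b, G (i z) (fderiv ℝ i z a) (s b) = 0) (v w : E') :
    connRicci (bilinChristoffel G) (i z) (s v) (s w) =
      connRicci (bilinChristoffel G') (f (i z)) v w := by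
  have hy := hi.mapsTo hz
  have hfi := fun u => IsFiberOn.fderiv_fderiv_eq_zero h hi hz u
  have hR := hi.map_curvature_submersion h hvert hz
  simp only [connRicci_apply]
  rw [trace_eq_add_of_splitting (ι := (fderiv ℝ i z).toLinearMap)
    (π := (fderiv ℝ f (i z)).toLinearMap) hsplit]
  have vert : ∀ x, fderiv ℝ f (i z) x = 0 → fderiv ℝ i z (p x) = x := by
    intro x hx
    have := hsplit x
    rwa [hx, map_zero, add_zero] at this
  -- For vertical `u` the vector `R(u, sv)sw` is vertical. By skewness its product with a vertical
  -- `x` is minus that of `sw` with `R(u, sv)x`, which is also vertical, hence orthogonal to `sw`.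
  -- So the vector is zero.
  have e1 : p ∘ₗ curvatureEnd (bilinChristoffel G) (i z) (s v) (s w) ∘ₗ
      (fderiv ℝ i z).toLinearMap = 0 := by
    ext u
    simp only [LinearMap.comp_apply, curvatureEnd_apply, ContinuousLinearMap.coe_coe,
      LinearMap.zero_apply]
    have h1 : ∀ x : F, G (i z) (connCurvature (bilinChristoffel G) (i z) (fderiv ℝ i z u) (s v)
        (s w)) (fderiv ℝ i z x) = 0 := by
      intro x
      have hsk := h.metric.connCurvature_skew hy (fderiv ℝ i z u) (s v) (s w) (fderiv ℝ i z x)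
      rw [← vert (connCurvature (bilinChristoffel G) (i z) (fderiv ℝ i z u) (s v)
        (fderiv ℝ i z x)) (by rw [hR, hfi, hfi]; simp [connCurvature]),
        h.metric.symm _ hy (s w), horth, add_zero] at hsk
      exact hsk
    have h2 := vert (connCurvature (bilinChristoffel G) (i z) (fderiv ℝ i z u) (s v) (s w))
      (by rw [hR, hfi]; simp [connCurvature])
    have h3 : connCurvature (bilinChristoffel G) (i z) (fderiv ℝ i z u) (s v) (s w) = 0 := by
      by_contra hne
      have := h.metric.pos _ hy _ hne
      nth_rewrite 2 [← h2] at this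
      rw [h1] at this
      exact this.false
    rw [h3, map_zero]
  have e2 : (fderiv ℝ f (i z)).toLinearMap ∘ₗ
      curvatureEnd (bilinChristoffel G) (i z) (s v) (s w) ∘ₗ s =
      curvatureEnd (bilinChristoffel G') (f (i z)) v w := by
    ext u
    simp only [LinearMap.comp_apply, curvatureEnd_apply, ContinuousLinearMap.coe_coe]
    rw [hR, hs, hs, hs]
  rw [e1, e2, map_zero, zero_add]

theorem IsFiberOn.localRicci_fiber (v w : F) :
    localRicci G (i z) (fderiv ℝ i z v) (fderiv ℝ i z w) = localRicci GF z v w := by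
  rw [h.metric.localRicci_eq (hi.mapsTo hz), hi.metric.localRicci_eq hz,
    hi.connRicci_fiber h hvert hz]

/-- The two diagonal blocks of the Ricci endomorphism are those of the fiber and of the base: each
is tested against its own metric, and orthogonality discards the off-diagonal part. -/
theorem IsFiberOn.localScalar_eq :
    localScalar G (i z) = localScalar GF z + localScalar G' (f (i z)) := by
  have hy := hi.mapsTo hz
  obtain ⟨p, s, hp, hs, hsplit, horth, hiso⟩ := hi.exists_splitting h hz
  rw [h.metric.localScalar_eq hy, hi.metric.localScalar_eq hz,
    h.metric'.localScalar_eq (h.mapsTo hy),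
    trace_eq_add_of_splitting (ι := (fderiv ℝ i z).toLinearMap)
    (π := (fderiv ℝ f (i z)).toLinearMap) hsplit]
  congr 2
  · ext v
    refine eq_of_posDef (hi.metric.pos z hz) fun w => ?_
    rw [hi.metric.apply_ricciEnd hz, hi.isometric z hz, ← hi.connRicci_fiber h hvert hz,
      ← h.metric.apply_ricciEnd hy]
    simp only [LinearMap.comp_apply, ContinuousLinearMap.coe_coe]
    conv_rhs => rw [← hsplit (ricciEnd G (i z) (fderiv ℝ i z v))]
    rw [map_add, add_apply, h.metric.symm _ hy (s _), horth, add_zero]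
  · ext v
    refine eq_of_posDef (h.metric'.pos _ (h.mapsTo hy)) fun w => ?_
    rw [h.metric'.apply_ricciEnd (h.mapsTo hy), ← hiso,
      ← hi.connRicci_horizontal h hvert hz hs hsplit horth, ← h.metric.apply_ricciEnd hy]
    simp only [LinearMap.comp_apply, ContinuousLinearMap.coe_coe]
    conv_rhs => rw [← hsplit (ricciEnd G (i z) (s v))]
    rw [map_add, add_apply, horth, zero_add]

end

end Traces

/-! ### Maps between manifolds written in charts. -/

section LocalRepresentatives

variable {E E₂ : Type*} [TopologicalSpace E] [TopologicalSpace E₂]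
  {M : Type*} [TopologicalSpace M] [ChartedSpace E M]
  {M₂ : Type*} [TopologicalSpace M₂] [ChartedSpace E₂ M₂]

/-- The map `Φ`, written in the charts centered at `c` and `c₂`. -/
def localRep (E E₂ : Type*) [TopologicalSpace E] [TopologicalSpace E₂] [ChartedSpace E M]
    [ChartedSpace E₂ M₂] (Φ : M → M₂) (c : M) (c₂ : M₂) (y : E) : E₂ :=
  chartAt E₂ c₂ (Φ ((chartAt E c).symm y))

/-- The domain of the local representative of `Φ`. -/
def localDom (E E₂ : Type*) [TopologicalSpace E] [TopologicalSpace E₂] [ChartedSpace E M]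
    [ChartedSpace E₂ M₂] (Φ : M → M₂) (c : M)
    (c₂ : M₂) : Set E :=
  (chartAt E c).target ∩ (chartAt E c).symm ⁻¹' (Φ ⁻¹' (chartAt E₂ c₂).source)

theorem isOpen_localDom {Φ : M → M₂} (hΦ : Continuous Φ) (c : M) (c₂ : M₂) :
    IsOpen (localDom E E₂ Φ c c₂) :=
  (chartAt E c).isOpen_inter_preimage_symm ((chartAt E₂ c₂).open_source.preimage hΦ)

theorem mem_localDom {Φ : M → M₂} {c x : M} {c₂ : M₂} (hx : x ∈ (chartAt E c).source)
    (hΦ : Φ x ∈ (chartAt E₂ c₂).source) : chartAt E c x ∈ localDom E E₂ Φ c c₂ :=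
  ⟨(chartAt E c).map_source hx, by simpa [(chartAt E c).left_inv hx] using hΦ⟩

/-- Induction principle: a point of the domain of the local representative is the image of a
point of the manifold. -/
theorem forall_localDom {Φ : M → M₂} {c : M} {c₂ : M₂} {P : E → Prop}
    (h : ∀ x ∈ (chartAt E c).source, Φ x ∈ (chartAt E₂ c₂).source → P (chartAt E c x)) :
    ∀ y ∈ localDom E E₂ Φ c c₂, P y := by
  rintro y ⟨hy, hy'⟩
  have := h _ ((chartAt E c).map_target hy) hy'
  rwa [(chartAt E c).right_inv hy] at this

theorem localRep_chart {Φ : M → M₂} {c x : M} (c₂ : M₂) (hx : x ∈ (chartAt E c).source) :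
    localRep E E₂ Φ c c₂ (chartAt E c x) = chartAt E₂ c₂ (Φ x) := by
  rw [localRep, (chartAt E c).left_inv hx]

end LocalRepresentatives

/-! ### Metrics, vector fields and derivatives in chart coordinates. -/

section ChartCoordinates

variable {E : Type*} [NormedAddCommGroup E] [NormedSpace ℝ E]
  {M : Type*} [TopologicalSpace M] [ChartedSpace E M]

/-- The derivative at `x` of the chart centered at `c`. -/
noncomputable def coordD (c x : M) : TangentSpace 𝓘(ℝ, E) x →L[ℝ] E :=
  mfderiv 𝓘(ℝ, E) 𝓘(ℝ, E) (chartAt E c) x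

theorem toChart_eq (p : M) : toChart (E := E) p = coordD p p := rfl

variable [IsManifold 𝓘(ℝ, E) ∞ M]

theorem mdifferentiable_chart_top (c : M) :
    (chartAt E c).MDifferentiable 𝓘(ℝ, E) 𝓘(ℝ, E) :=
  mdifferentiable_chart c

theorem coordD_bijective {c x : M} (hx : x ∈ (chartAt E c).source) :
    Function.Bijective (coordD (E := E) c x) :=
  (mdifferentiable_chart_top c).mfderiv_bijective hx

theorem coordD_isInvertible {c x : M} (hx : x ∈ (chartAt E c).source) :
    (coordD (E := E) c x).IsInvertible :=
  ⟨(mdifferentiable_chart_top c).mfderiv hx, rfl⟩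

theorem coordD_inverse {c x : M} (hx : x ∈ (chartAt E c).source) (e : E) :
    coordD c x ((coordD c x).inverse e) = e := by
  obtain ⟨L, hL⟩ := coordD_isInvertible hx
  rw [← hL]
  simp

theorem fromChart_coordD {c x : M} (hx : x ∈ (chartAt E c).source) (a : TangentSpace 𝓘(ℝ, E) x) :
    (fromChart c (chartAt E c x) (coordD c x a) : E) = a :=
  DFunLike.congr_fun ((mdifferentiable_chart_top c).symm_comp_deriv hx) a

theorem coordD_fromChart {c : M} {y : E} (hy : y ∈ (chartAt E c).target) (e : E) :
    coordD c ((chartAt E c).symm y) (fromChart c y e) = e :=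
  DFunLike.congr_fun ((mdifferentiable_chart_top c).comp_symm_deriv hy) e

theorem chartField_eq {V : Π x : M, TangentSpace 𝓘(ℝ, E) x} {c : M} {y : E}
    (hy : y ∈ (chartAt E c).target) :
    chartField V c y = coordD c ((chartAt E c).symm y) (V ((chartAt E c).symm y)) := by
  have hinv : (fromChart c y).IsInvertible :=
    ⟨(mdifferentiable_chart_top c).symm.mfderiv (x := y) hy, rfl⟩
  obtain ⟨L, hL⟩ := hinv
  rw [chartField, ← hL, ContinuousLinearMap.inverse_equiv]
  refine L.injective ?_
  rw [ContinuousLinearEquiv.coe_coe, L.apply_symm_apply]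
  have h := fromChart_coordD ((chartAt E c).map_target hy) (V ((chartAt E c).symm y))
  rw [(chartAt E c).right_inv hy] at h
  have h2 := DFunLike.congr_fun hL (coordD c ((chartAt E c).symm y) (V ((chartAt E c).symm y)))
  exact h.symm.trans h2.symm

theorem chartMetric_coordD (g : RMetric E M) {c x : M} (hx : x ∈ (chartAt E c).source)
    (a b : TangentSpace 𝓘(ℝ, E) x) :
    chartMetric g c (chartAt E c x) (coordD c x a) (coordD c x b) = g.inner x a b := by
  -- The base points `x` and `φ⁻¹(φ x)` are equal only propositionally, so the point is generalized
  -- before substituting.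
  have key : ∀ x' (_ : x' = x) (a' b' : E), a' = a → b' = b →
      g.inner x' a' b' = g.inner x a b := by
    rintro x' rfl a' b' rfl rfl
    rfl
  exact key _ ((chartAt E c).left_inv hx) _ _ (fromChart_coordD hx a) (fromChart_coordD hx b)

/-- Smoothness of a vector field can be checked in a chart. -/
theorem contMDiffAt_field_iff {V : Π x : M, TangentSpace 𝓘(ℝ, E) x} {c x : M}
    (hx : x ∈ (chartAt E c).source) :
    ContMDiffAt 𝓘(ℝ, E) 𝓘(ℝ, E).tangent ∞
      (fun x => (⟨x, V x⟩ : TangentBundle 𝓘(ℝ, E) M)) x ↔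
    ContMDiffAt 𝓘(ℝ, E) 𝓘(ℝ, E) ∞ (fun x => coordD c x (V x)) x := by
  have hb : x ∈ (trivializationAt E (TangentSpace 𝓘(ℝ, E) : M → Type _) c).baseSet := by
    rwa [TangentBundle.trivializationAt_baseSet]
  refine ((trivializationAt E (TangentSpace 𝓘(ℝ, E) : M → Type _) c).contMDiffAt_section_iff
    (IB := 𝓘(ℝ, E)) (n := ∞) (s := V) hb).trans ?_
  -- Near `x` the tangent bundle trivialization at `c` is the derivative of the chart at `c`.
  have e : (fun x => (trivializationAt E (TangentSpace 𝓘(ℝ, E) : M → Type _) c ⟨x, V x⟩).2)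
      =ᶠ[𝓝 x] fun x => coordD c x (V x) := by
    filter_upwards [(chartAt E c).open_source.mem_nhds hx] with a ha
    have h1 := TangentBundle.continuousLinearMapAt_trivializationAt (I := 𝓘(ℝ, E)) ha
    have h2 := DFunLike.congr_fun h1 (V a)
    have ha' : a ∈ (trivializationAt E (TangentSpace 𝓘(ℝ, E) : M → Type _) c).baseSet := by
      rwa [TangentBundle.trivializationAt_baseSet]
    rw [Bundle.Trivialization.continuousLinearMapAt_apply,
      Bundle.Trivialization.linearMapAt_apply, if_pos ha'] at h2
    exact h2
  exact e.contMDiffAt_iff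

theorem contDiffAt_comp_chart_symm {E₁ : Type*} [NormedAddCommGroup E₁] [NormedSpace ℝ E₁]
    {h : M → E₁} {c : M} {y : E} (hy : y ∈ (chartAt E c).target)
    (hh : ContMDiffAt 𝓘(ℝ, E) 𝓘(ℝ, E₁) ∞ h ((chartAt E c).symm y)) :
    ContDiffAt ℝ ∞ (fun z => h ((chartAt E c).symm z)) y :=
  (hh.comp y ((contMDiffOn_chart_symm (I := 𝓘(ℝ, E)) (n := ∞) (x := c)).contMDiffAt
    ((chartAt E c).open_target.mem_nhds hy))).contDiffAt

theorem contDiffAt_chartField (V : VField E M) {c : M} {y : E} (hy : y ∈ (chartAt E c).target) :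
    ContDiffAt ℝ ∞ (chartField V c) y := by
  have hx := (chartAt E c).map_target hy
  refine (contDiffAt_comp_chart_symm hy
    ((contMDiffAt_field_iff hx).1 (V.contMDiff _))).congr_of_eventuallyEq ?_
  filter_upwards [(chartAt E c).open_target.mem_nhds hy] with z hz using chartField_eq hz

/-- In finite dimension smoothness may be tested on constant vectors. These come from the coordinate
fields on `M`, which are smooth because they are constant in the chart. -/
theorem isMetricOn_chartMetric [FiniteDimensional ℝ E] (g : RMetric E M) (c : M) :
    IsMetricOn (chartMetric g c) (chartAt E c).target where
  isOpen := (chartAt E c).open_target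
  symm y _ u v := g.symm _ _ _
  pos y hy v hv := g.pos _ _ (fun h => hv (by
    rw [← coordD_fromChart hy v]
    exact (congrArg _ h).trans (map_zero _)))
  contDiffOn := by
    refine contDiffOn_clm_apply.2 fun u => contDiffOn_clm_apply.2 fun v y hy => ?_
    have hx := (chartAt E c).map_target hy
    have hfield : ∀ e : E, ContMDiffAt 𝓘(ℝ, E) 𝓘(ℝ, E).tangent ∞
        (fun x => (⟨x, (coordD c x).inverse e⟩ : TangentBundle 𝓘(ℝ, E) M))
        ((chartAt E c).symm y) := by
      intro e
      rw [contMDiffAt_field_iff hx]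
      refine (contMDiffAt_const (c := e)).congr_of_eventuallyEq ?_
      filter_upwards [(chartAt E c).open_source.mem_nhds hx] with a ha using coordD_inverse ha e
    have h1 : ContMDiffAt 𝓘(ℝ, E) 𝓘(ℝ, ℝ) ∞
        (fun x => g.inner x ((coordD c x).inverse u) ((coordD c x).inverse v))
        ((chartAt E c).symm y) := by
      have := ContMDiffAt.clm_bundle_apply₂ (F₁ := E) (F₂ := E) (F₃ := ℝ)
        (E₃ := Bundle.Trivial M ℝ) (g.contMDiff ((chartAt E c).symm y)) (hfield u) (hfield v)
      exact ((Bundle.contMDiffAt_totalSpace).1 this).2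
    refine (ContDiffAt.congr_of_eventuallyEq (contDiffAt_comp_chart_symm hy h1)
      ?_).contDiffWithinAt
    filter_upwards [(chartAt E c).open_target.mem_nhds hy] with z hz
    have h2 := chartMetric_coordD g ((chartAt E c).map_target hz)
      ((coordD c ((chartAt E c).symm z)).inverse u) ((coordD c ((chartAt E c).symm z)).inverse v)
    rwa [coordD_inverse ((chartAt E c).map_target hz), coordD_inverse ((chartAt E c).map_target hz),
      (chartAt E c).right_inv hz] at h2

variable {E₂ : Type*} [NormedAddCommGroup E₂] [NormedSpace ℝ E₂]
  {M₂ : Type*} [TopologicalSpace M₂] [ChartedSpace E₂ M₂] [IsManifold 𝓘(ℝ, E₂) ∞ M₂]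

theorem contDiffOn_localRep {Φ : M → M₂} (hΦ : ContMDiff 𝓘(ℝ, E) 𝓘(ℝ, E₂) ∞ Φ) (c : M)
    (c₂ : M₂) : ContDiffOn ℝ ∞ (localRep E E₂ Φ c c₂) (localDom E E₂ Φ c c₂) := by
  intro y hy
  have h1 := (contMDiffOn_chart (I := 𝓘(ℝ, E₂)) (n := ∞) (x := c₂)).contMDiffAt
    (x := Φ ((chartAt E c).symm y)) ((chartAt E₂ c₂).open_source.mem_nhds hy.2)
  exact (contDiffAt_comp_chart_symm hy.1
    (ContMDiffAt.comp ((chartAt E c).symm y) h1 (hΦ ((chartAt E c).symm y)))).contDiffWithinAt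

theorem fderiv_localRep {Φ : M → M₂} (hΦ : ContMDiff 𝓘(ℝ, E) 𝓘(ℝ, E₂) ∞ Φ) {c x : M} {c₂ : M₂}
    (hx : x ∈ (chartAt E c).source) (hΦx : Φ x ∈ (chartAt E₂ c₂).source)
    (a : TangentSpace 𝓘(ℝ, E) x) :
    fderiv ℝ (localRep E E₂ Φ c c₂) (chartAt E c x) (coordD c x a) =
      coordD c₂ (Φ x) (mfderiv 𝓘(ℝ, E) 𝓘(ℝ, E₂) Φ x a) := by
  have e : localRep E E₂ Φ c c₂ ∘ chartAt E c =ᶠ[𝓝 x] chartAt E₂ c₂ ∘ Φ := by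
    filter_upwards [(chartAt E c).open_source.mem_nhds hx] with z hz using localRep_chart c₂ hz
  have h1 : MDifferentiableAt 𝓘(ℝ, E) 𝓘(ℝ, E₂) (localRep E E₂ Φ c c₂) (chartAt E c x) := by
    refine DifferentiableAt.mdifferentiableAt ?_
    exact differentiableAt_of_contDiffAt_top ((contDiffOn_localRep hΦ c c₂).contDiffAt
      ((isOpen_localDom (E := E) (E₂ := E₂) hΦ.continuous c c₂).mem_nhds (mem_localDom hx hΦx)))
  have h2 := e.mfderiv_eq (I := 𝓘(ℝ, E)) (I' := 𝓘(ℝ, E₂))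
  rw [mfderiv_comp x h1 ((mdifferentiable_chart_top c).mdifferentiableAt hx),
    mfderiv_comp x ((mdifferentiable_chart_top c₂).mdifferentiableAt hΦx)
      (hΦ.mdifferentiableAt (by simp)), mfderiv_eq_fderiv] at h2
  exact DFunLike.congr_fun h2 a

end ChartCoordinates

/-! ### Second derivatives of compositions; naturality of the Lie derivative. -/

section Naturality

variable {E : Type*} [NormedAddCommGroup E] [NormedSpace ℝ E]
  {E₁ : Type*} [NormedAddCommGroup E₁] [NormedSpace ℝ E₁]
  {E₂ : Type*} [NormedAddCommGroup E₂] [NormedSpace ℝ E₂]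

/-- The second derivative of a composition. -/
theorem fderiv_fderiv_comp {f : E₁ → E₂} {φ : E → E₁} {k : E → E₂} {y : E}
    (hf : ContDiffAt ℝ ∞ f (φ y)) (hφ : ∀ᶠ z in 𝓝 y, ContDiffAt ℝ ∞ φ z)
    (hfφ : ∀ᶠ z in 𝓝 y, ContDiffAt ℝ ∞ f (φ z)) (hk : k =ᶠ[𝓝 y] f ∘ φ) (u w : E) :
    fderiv ℝ (fderiv ℝ k) y u w = fderiv ℝ (fderiv ℝ f) (φ y) (fderiv ℝ φ y u) (fderiv ℝ φ y w)
      + fderiv ℝ f (φ y) (fderiv ℝ (fderiv ℝ φ) y u w) := by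
  have hφy := hφ.self_of_nhds
  have hd := differentiableAt_of_contDiffAt_top hφy
  have hdd := differentiableAt_of_contDiffAt_top (contDiffAt_fderiv_top hφy)
  have hfd := differentiableAt_of_contDiffAt_top hf
  have hfdd := differentiableAt_of_contDiffAt_top (contDiffAt_fderiv_top hf)
  have e : fderiv ℝ k =ᶠ[𝓝 y] fun z => ((fderiv ℝ f ∘ φ) z).comp (fderiv ℝ φ z) := by
    filter_upwards [hk.eventuallyEq_nhds, hφ, hfφ] with z hz h1 h2
    rw [hz.fderiv_eq, fderiv_comp z (differentiableAt_of_contDiffAt_top h2)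
      (differentiableAt_of_contDiffAt_top h1)]
    rfl
  rw [e.fderiv_eq, fderiv_clm_comp (hfdd.comp y hd) hdd, fderiv_comp y hfdd hd]
  simp [add_comm]

/-- The Lie derivative of the metric, in coordinates, is natural under isometric maps and related
vector fields. -/
theorem lieDeriv_naturality {G₁ : E₁ → E₁ →L[ℝ] E₁ →L[ℝ] ℝ} {G₂ : E₂ → E₂ →L[ℝ] E₂ →L[ℝ] ℝ}
    {φ : E₁ → E₂} {y : E₁} {V₁ : E₁ → E₁} {V₂ : E₂ → E₂} (hG₁ : DifferentiableAt ℝ G₁ y)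
    (hG₂ : DifferentiableAt ℝ G₂ (φ y)) (hφ : ContDiffAt ℝ ∞ φ y) (hV₁ : DifferentiableAt ℝ V₁ y)
    (hV₂ : DifferentiableAt ℝ V₂ (φ y))
    (hiso : ∀ᶠ z in 𝓝 y, ∀ u v, G₁ z u v = G₂ (φ z) (fderiv ℝ φ z u) (fderiv ℝ φ z v))
    (hrel : ∀ᶠ z in 𝓝 y, fderiv ℝ φ z (V₁ z) = V₂ (φ z)) (u v : E₁) :
    fderiv ℝ (fun z => G₂ z (fderiv ℝ φ y u) (fderiv ℝ φ y v)) (φ y) (V₂ (φ y))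
      + G₂ (φ y) (fderiv ℝ V₂ (φ y) (fderiv ℝ φ y u)) (fderiv ℝ φ y v)
      + G₂ (φ y) (fderiv ℝ φ y u) (fderiv ℝ V₂ (φ y) (fderiv ℝ φ y v)) =
    fderiv ℝ (fun z => G₁ z u v) y (V₁ y) + G₁ y (fderiv ℝ V₁ y u) v
      + G₁ y u (fderiv ℝ V₁ y v) := by
  have hd := differentiableAt_of_contDiffAt_top hφ
  have hdd := differentiableAt_of_contDiffAt_top (contDiffAt_fderiv_top hφ)
  have c := fun (v : E₁) => differentiableAt_const (𝕜 := ℝ) (x := y) v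
  have e : (fun z => G₁ z u v) =ᶠ[𝓝 y]
      fun z => (G₂ ∘ φ) z (fderiv ℝ φ z u) (fderiv ℝ φ z v) := by
    filter_upwards [hiso] with z hz using hz u v
  have h1 := DFunLike.congr_fun (e.fderiv_eq (𝕜 := ℝ)) (V₁ y)
  have hc : DifferentiableAt ℝ (G₂ ∘ φ) y := hG₂.comp y hd
  rw [fderiv_clm_apply_const₂ hG₁,
    fderiv_clm_apply (hc.clm_apply (hdd.clm_apply (c u))) (hdd.clm_apply (c v)),
    fderiv_clm_apply hc (hdd.clm_apply (c u))] at h1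
  simp only [add_apply, ContinuousLinearMap.comp_apply, ContinuousLinearMap.flip_apply,
    fderiv_clm_apply_const hdd, fderiv_comp y hG₂ hd, Function.comp, hrel.self_of_nhds] at h1
  -- The derivative of the relation `dφ V₁ = V₂ ∘ φ`. Its second-derivative term also arises from
  -- differentiating the isometry condition, so the two sides match.
  have hV : ∀ u, fderiv ℝ V₂ (φ y) (fderiv ℝ φ y u) =
      fderiv ℝ (fderiv ℝ φ) y (V₁ y) u + fderiv ℝ φ y (fderiv ℝ V₁ y u) := by
    intro u
    have e' : (fun z => fderiv ℝ φ z (V₁ z)) =ᶠ[𝓝 y] V₂ ∘ φ := hrel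
    have h2 := DFunLike.congr_fun (e'.fderiv_eq (𝕜 := ℝ)) u
    rw [fderiv_clm_apply hdd hV₁, fderiv_comp y hV₂ hd] at h2
    simp only [add_apply, ContinuousLinearMap.comp_apply, ContinuousLinearMap.flip_apply] at h2
    rw [← h2, fderiv_fderiv_symm hφ u]
    abel
  rw [fderiv_clm_apply_const₂ hG₂, fderiv_clm_apply_const₂ hG₁, h1, hV, hV,
    hiso.self_of_nhds, hiso.self_of_nhds]
  simp only [map_add, add_apply]
  ring

end Naturality

/-! ### Parallelism of the vertical distribution in a fixed chart. -/

section VerticalDistribution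

variable {E : Type*} [NormedAddCommGroup E] [NormedSpace ℝ E]
  {M : Type*} [TopologicalSpace M] [ChartedSpace E M] [IsManifold 𝓘(ℝ, E) ∞ M]
  {E' : Type*} [NormedAddCommGroup E'] [NormedSpace ℝ E']
  {N : Type*} [TopologicalSpace N] [ChartedSpace E' N] [IsManifold 𝓘(ℝ, E') ∞ N]
  {g : RMetric E M} {gN : RMetric E' N} {π : M → N}

/-- A Riemannian submersion, written in charts. -/
theorem IsRiemannianSubmersion.isSubmersionOn_localRep [FiniteDimensional ℝ E]
    [FiniteDimensional ℝ E'] (hπ : IsRiemannianSubmersion g gN π) (p : M) (q : N) :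
    IsSubmersionOn (chartMetric g p) (localDom E E' π p q) (chartMetric gN q)
      (chartAt E' q).target (localRep E E' π p q) where
  metric := (isMetricOn_chartMetric g p).mono (isOpen_localDom hπ.contMDiff.continuous p q)
    Set.inter_subset_left
  metric' := isMetricOn_chartMetric gN q
  mapsTo y hy := (chartAt E' q).map_source hy.2
  contDiffOn := contDiffOn_localRep hπ.contMDiff p q
  surjective := by
    refine forall_localDom fun x hx hπx e => ?_
    obtain ⟨b, rfl⟩ := (coordD_bijective hπx).2 e
    obtain ⟨a, rfl⟩ := hπ.surjective_mfderiv x b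
    exact ⟨coordD p x a, fderiv_localRep hπ.contMDiff hx hπx a⟩
  isometry := by
    refine forall_localDom fun x hx hπx u hu => ?_
    obtain ⟨a, rfl⟩ := (coordD_bijective hx).2 u
    rw [localRep_chart q hx, fderiv_localRep hπ.contMDiff hx hπx, chartMetric_coordD _ hπx,
      chartMetric_coordD _ hx]
    refine hπ.isometry x a fun w hw => ?_
    rw [← chartMetric_coordD g hx]
    refine hu _ ?_
    rw [fderiv_localRep hπ.contMDiff hx hπx, hw, map_zero]

/-- The Hessian of the local representative of a Riemannian submersion with parallel vertical
distribution vanishes on vertical vectors, at the center of the chart. -/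
theorem VerticalParallel.hessian_localRep_center [FiniteDimensional ℝ E] [FiniteDimensional ℝ E']
    (hpar : VerticalParallel (E' := E') g π) (hπ : IsRiemannianSubmersion g gN π) {x : M} {q : N}
    (hx : π x ∈ (chartAt E' q).source) (u w : E)
    (hw : fderiv ℝ (localRep E E' π x q) (chartAt E x x) w = 0) :
    fderiv ℝ (fderiv ℝ (localRep E E' π x q)) (chartAt E x x) u w =
      fderiv ℝ (localRep E E' π x q) (chartAt E x x)
        (bilinChristoffel (chartMetric g x) (chartAt E x x) u w) := by
  have hsub := hπ.isSubmersionOn_localRep x q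
  have hxs := mem_chart_source E x
  have hy : chartAt E x x ∈ localDom E E' π x q := mem_localDom hxs hx
  have hD := isOpen_localDom (E := E) (E₂ := E') hπ.contMDiff.continuous x q
  set f := localRep E E' π x q with hf
  -- A smooth vertical extension of `w`: remove the horizontal part of the constant field. At the
  -- center nothing is removed, since `w` is vertical there.
  set W₀ : E → E := fun y => w - horizontalProj (chartMetric g x) (chartMetric gN q) f y w
    with hW₀
  set W : Π z : M, TangentSpace 𝓘(ℝ, E) z :=
    fun z => (coordD x z).inverse (W₀ (chartAt E x z)) with hW
  have hvert : ∀ y ∈ localDom E E' π x q, fderiv ℝ f y (W₀ y) = 0 := by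
    intro y hy
    rw [hW₀, map_sub, hsub.fderiv_horizontalProj hy, sub_self]
  have hW₀d : ∀ y ∈ localDom E E' π x q, ContDiffAt ℝ ∞ W₀ y := fun y hy =>
    contDiffAt_const.sub ((hsub.contDiffAt_horizontalProj hy).clm_apply contDiffAt_const)
  have hcov := hpar ((chartAt E x).source ∩ π ⁻¹' (chartAt E' q).source) W
    ((chartAt E x).open_source.inter ((chartAt E' q).open_source.preimage
      hπ.contMDiff.continuous)) (by
        rintro z ⟨hz, hz'⟩
        refine ((contMDiffAt_field_iff hz).2 ?_).contMDiffWithinAt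
        have h1 : ContMDiffAt 𝓘(ℝ, E) 𝓘(ℝ, E) ∞ (fun z => W₀ (chartAt E x z)) z :=
          ContMDiffAt.comp (g := W₀) z (hW₀d _ (mem_localDom hz hz')).contMDiffAt
            ((contMDiffOn_chart (I := 𝓘(ℝ, E)) (n := ∞) (x := x)).contMDiffAt
              ((chartAt E x).open_source.mem_nhds hz))
        refine h1.congr_of_eventuallyEq ?_
        filter_upwards [(chartAt E x).open_source.mem_nhds hz] with a ha
          using coordD_inverse ha _) (by
        rintro z ⟨hz, hz'⟩
        refine (coordD_bijective hz').1 ?_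
        rw [← fderiv_localRep hπ.contMDiff hz hz', hW, coordD_inverse hz, map_zero]
        exact hvert _ (mem_localDom hz hz')) x ⟨hxs, hx⟩ ((coordD x x).inverse u)
  have hcov' := congrArg (coordD q (π x)) hcov
  rw [map_zero, ← fderiv_localRep hπ.contMDiff hxs hx] at hcov'
  rw [covDeriv, toChart_eq, coordD_inverse hxs, coordD_inverse hxs] at hcov'
  have e : chartField W x =ᶠ[𝓝 (chartAt E x x)] W₀ := by
    filter_upwards [(chartAt E x).open_target.mem_nhds (mem_chart_target E x)] with y hy
    rw [chartField_eq hy, hW, coordD_inverse ((chartAt E x).map_target hy),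
      (chartAt E x).right_inv hy]
  have hW₀x : W₀ (chartAt E x x) = w := by
    rw [hW₀]
    simp only
    rw [IsSubmersionOn.horizontalProj_of_vertical hw, sub_zero]
  rw [e.fderiv_eq, e.eq_of_nhds, hW₀x, christoffel_eq (hsub.metric.differentiableAt hy),
    map_add] at hcov'
  have hfd := differentiableAt_of_contDiffAt_top (contDiffAt_fderiv_top (hsub.contDiffAt hy))
  -- Differentiating `df (W₀) = 0` trades the derivative of `W₀` in the parallelism condition for
  -- the Hessian of `f`.
  have e2 : (fun y => fderiv ℝ f y (W₀ y)) =ᶠ[𝓝 (chartAt E x x)] fun _ => 0 := by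
    filter_upwards [hD.mem_nhds hy] with y hy using hvert y hy
  have h3 := DFunLike.congr_fun (e2.fderiv_eq (𝕜 := ℝ)) u
  rw [fderiv_clm_apply hfd (differentiableAt_of_contDiffAt_top (hW₀d _ hy)), hW₀x] at h3
  simp only [add_apply, ContinuousLinearMap.comp_apply, ContinuousLinearMap.flip_apply,
    fderiv_fun_const, Pi.zero_apply, zero_apply] at h3
  rw [eq_neg_of_add_eq_zero_left h3] at hcov'
  exact (neg_add_eq_zero.1 hcov')

/-- The Hessian of the local representative of a Riemannian submersion with parallel vertical
distribution vanishes on vertical vectors. -/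
theorem VerticalParallel.isVerticalParallelOn_localRep [FiniteDimensional ℝ E]
    [FiniteDimensional ℝ E'] (hpar : VerticalParallel (E' := E') g π)
    (hπ : IsRiemannianSubmersion g gN π) (p : M) (q : N) :
    IsVerticalParallelOn (chartMetric g p) (localDom E E' π p q) (localRep E E' π p q) := by
  refine forall_localDom fun x hx hπx u w hw => ?_
  have hid : ContMDiff 𝓘(ℝ, E) 𝓘(ℝ, E) ∞ (id : M → M) := contMDiff_id
  have hxs := mem_chart_source E x
  -- The transition map from the fixed chart at `p` to the chart centered at `x`, where parallelism
  -- is known at the center.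
  set φ := localRep E E (id : M → M) p x with hφdef
  have hy : chartAt E p x ∈ localDom E E (id : M → M) p x := mem_localDom hx hxs
  have hDφ := isOpen_localDom (E := E) (E₂ := E) (continuous_id : Continuous (id : M → M)) p x
  have hDπ := isOpen_localDom (E := E) (E₂ := E') hπ.contMDiff.continuous p q
  have hφ : ∀ᶠ z in 𝓝 (chartAt E p x), ContDiffAt ℝ ∞ φ z := by
    filter_upwards [hDφ.mem_nhds hy] with z hz
      using (contDiffOn_localRep hid p x).contDiffAt (hDφ.mem_nhds hz)
  have hφx : φ (chartAt E p x) = chartAt E x x := localRep_chart x hx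
  have hsub := hπ.isSubmersionOn_localRep x q
  have hsubp := hπ.isSubmersionOn_localRep p q
  have hyπ : chartAt E p x ∈ localDom E E' π p q := mem_localDom hx hπx
  have hyx : chartAt E x x ∈ localDom E E' π x q := mem_localDom hxs hπx
  have hev : ∀ᶠ z in 𝓝 (chartAt E p x),
      ContDiffAt ℝ ∞ (localRep E E' π x q) (φ z) ∧
      localRep E E' π p q z = localRep E E' π x q (φ z) := by
    filter_upwards [hDφ.mem_nhds hy, hDπ.mem_nhds hyπ] with z hz hz'
    have hφz : φ z ∈ localDom E E' π x q := mem_localDom hz.2 hz'.2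
    refine ⟨hsub.contDiffAt hφz, ?_⟩
    exact (localRep_chart q hz.2).symm
  have hiso : ∀ᶠ z in 𝓝 (chartAt E p x), ∀ u v, chartMetric g p z u v =
      chartMetric g x (φ z) (fderiv ℝ φ z u) (fderiv ℝ φ z v) := by
    filter_upwards [hDφ.mem_nhds hy] with z hz
    revert z
    refine forall_localDom fun a ha ha' u v => ?_
    obtain ⟨u, rfl⟩ := (coordD_bijective ha).2 u
    obtain ⟨v, rfl⟩ := (coordD_bijective ha).2 v
    rw [fderiv_localRep hid ha ha', fderiv_localRep hid ha ha', hφdef, localRep_chart x ha,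
      chartMetric_coordD g ha, mfderiv_id]
    exact (chartMetric_coordD g ha' u v).symm
  have hcomp : fderiv ℝ (localRep E E' π p q) (chartAt E p x) =
      (fderiv ℝ (localRep E E' π x q) (φ (chartAt E p x))).comp
        (fderiv ℝ φ (chartAt E p x)) := by
    rw [← fderiv_comp _ (differentiableAt_of_contDiffAt_top hev.self_of_nhds.1)
      (differentiableAt_of_contDiffAt_top hφ.self_of_nhds)]
    exact Filter.EventuallyEq.fderiv_eq (hev.mono fun z hz => hz.2)
  -- The transition map is isometric with surjective derivative, so the tangential part in the
  -- Koszul comparison is everything and the map is affine.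
  have haff : fderiv ℝ φ (chartAt E p x) (bilinChristoffel (chartMetric g p) (chartAt E p x) u w) =
      fderiv ℝ (fderiv ℝ φ) (chartAt E p x) u w
      + bilinChristoffel (chartMetric g x) (φ (chartAt E p x)) (fderiv ℝ φ (chartAt E p x) u)
        (fderiv ℝ φ (chartAt E p x) w) := by
    refine eq_of_posDef (hsub.metric.pos _ hyx) fun e => ?_
    obtain ⟨a, rfl⟩ := (coordD_bijective hxs).2 e
    have h1 : fderiv ℝ φ (chartAt E p x) (coordD p x a) = coordD x x a := by
      rw [fderiv_localRep hid hx hxs, mfderiv_id]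
      rfl
    have h2 := christoffel_of_isometric hsubp.metric hsub.metric hyπ (by rwa [hφx])
      hφ.self_of_nhds hiso u w (coordD p x a)
    rw [h1, hφx] at h2
    rwa [hφx]
  rw [hcomp, ContinuousLinearMap.comp_apply, hφx] at hw
  have hc := hpar.hessian_localRep_center hπ hπx (fderiv ℝ φ (chartAt E p x) u) _ hw
  rw [fderiv_fderiv_comp hev.self_of_nhds.1 hφ (hev.mono fun z hz => hz.1)
    (hev.mono fun z hz => hz.2) u w, hcomp, ContinuousLinearMap.comp_apply, haff, hφx, map_add, hc,
    add_comm]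

end VerticalDistribution

/-! ### Restriction of fields and tensors to an embedded fiber. -/

section Fibers

/-- If `A` is injective, `B` is surjective and `B ∘ A = 0`, the sequence `A`, `B` is exact as soon as
the dimensions add up. -/
theorem exists_preimage_of_finrank {E E' F : Type*} [AddCommGroup E] [Module ℝ E]
    [AddCommGroup E'] [Module ℝ E'] [AddCommGroup F] [Module ℝ F] [FiniteDimensional ℝ E]
    {A : F →ₗ[ℝ] E} {B : E →ₗ[ℝ] E'}
    (hA : Function.Injective A) (hB : Function.Surjective B) (hBA : ∀ v, B (A v) = 0)
    (hdim : Module.finrank ℝ F + Module.finrank ℝ E' = Module.finrank ℝ E) {x : E}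
    (hx : B x = 0) : ∃ v, A v = x := by
  have hle : A.range ≤ B.ker := by
    rintro _ ⟨v, rfl⟩
    exact hBA v
  have h1 := LinearMap.finrank_range_of_inj hA
  have h2 := B.finrank_range_add_finrank_ker
  rw [LinearMap.range_eq_top.2 hB, finrank_top] at h2
  have := Submodule.eq_of_le_of_finrank_eq hle (by omega)
  have hx' : x ∈ A.range := this ▸ hx
  exact hx'

variable {E : Type*} [NormedAddCommGroup E] [NormedSpace ℝ E]
  {M : Type*} [TopologicalSpace M] [ChartedSpace E M] [IsManifold 𝓘(ℝ, E) ∞ M]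
  {F : Type*} [NormedAddCommGroup F] [NormedSpace ℝ F]
  {S : Type*} [TopologicalSpace S] [ChartedSpace F S] [IsManifold 𝓘(ℝ, F) ∞ S]

theorem chartField_chart (V : Π x : M, TangentSpace 𝓘(ℝ, E) x) {c x : M}
    (hx : x ∈ (chartAt E c).source) : chartField V c (chartAt E c x) = coordD c x (V x) := by
  rw [chartField_eq ((chartAt E c).map_source hx)]
  have key : ∀ x', x' = x → (coordD c x' (V x') : E) = coordD c x (V x) := by
    rintro x' rfl
    rfl
  exact key _ ((chartAt E c).left_inv hx)

variable [FiniteDimensional ℝ F] {g : RMetric E M} {j : S → M}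
  (hj : Manifold.IsSmoothEmbedding 𝓘(ℝ, F) 𝓘(ℝ, E) ∞ j)

include hj

theorem chartMetric_inducedMetric {c x : S} {p : M} (hx : x ∈ (chartAt F c).source)
    (hjx : j x ∈ (chartAt E p).source) (u v : F) :
    chartMetric (inducedMetric g j hj) c (chartAt F c x) u v =
      chartMetric g p (localRep F E j c p (chartAt F c x))
        (fderiv ℝ (localRep F E j c p) (chartAt F c x) u)
        (fderiv ℝ (localRep F E j c p) (chartAt F c x) v) := by
  obtain ⟨a, rfl⟩ := (coordD_bijective hx).2 u
  obtain ⟨b, rfl⟩ := (coordD_bijective hx).2 v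
  rw [chartMetric_coordD _ hx, fderiv_localRep hj.contMDiff hx hjx,
    fderiv_localRep hj.contMDiff hx hjx, localRep_chart p hx, chartMetric_coordD g hjx]
  rfl

variable {E' : Type*} [NormedAddCommGroup E'] [NormedSpace ℝ E']
  {N : Type*} [TopologicalSpace N] [ChartedSpace E' N] [IsManifold 𝓘(ℝ, E') ∞ N]
  {gN : RMetric E' N} {π : M → N} {q : N}

/-- A fiber of a Riemannian submersion, written in charts. -/
theorem IsRiemannianSubmersion.isFiberOn_localRep (hπ : IsRiemannianSubmersion g gN π)
    (hq : ∀ x, π (j x) = q)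
    (hker : ∀ x w, mfderiv 𝓘(ℝ, E) 𝓘(ℝ, E') π (j x) w = 0 →
      ∃ v, mfderiv 𝓘(ℝ, F) 𝓘(ℝ, E) j x v = w) (x : S) (p : M) :
    IsFiberOn (chartMetric g p) (localDom E E' π p q) (localRep E E' π p q)
      (chartMetric (inducedMetric g j hj) x) (localDom F E j x p) (localRep F E j x p) where
  metric := (isMetricOn_chartMetric _ x).mono
    (isOpen_localDom hj.contMDiff.continuous x p) Set.inter_subset_left
  mapsTo := by
    refine forall_localDom fun a ha hja => ?_
    rw [localRep_chart p ha]
    exact mem_localDom hja (by rw [hq]; exact mem_chart_source E' q)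
  contDiffOn := contDiffOn_localRep hj.contMDiff x p
  isometric := forall_localDom fun a ha hja => chartMetric_inducedMetric hj ha hja
  const := by
    refine ⟨chartAt E' q q, forall_localDom fun a ha hja => ?_⟩
    rw [localRep_chart p ha, localRep_chart q hja, hq]
  exists_eq := by
    refine forall_localDom fun a ha hja w hw => ?_
    have hqs : π (j a) ∈ (chartAt E' q).source := by rw [hq]; exact mem_chart_source E' q
    obtain ⟨w, rfl⟩ := (coordD_bijective hja).2 w
    rw [localRep_chart p ha, fderiv_localRep hπ.contMDiff hja hqs] at hw
    obtain ⟨v, rfl⟩ := hker a w ((coordD_bijective hqs).1 (hw.trans (map_zero _).symm))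
    exact ⟨coordD x a v, fderiv_localRep hj.contMDiff ha hja v⟩

variable [FiniteDimensional ℝ E]

omit [IsManifold 𝓘(ℝ, F) ∞ S] [FiniteDimensional ℝ F] in
/-- The vectors tangent to a fiber of a submersion are the vertical ones. -/
theorem IsRiemannianSubmersion.exists_mfderiv_eq (hπ : IsRiemannianSubmersion g gN π)
    (hdim : Module.finrank ℝ F + Module.finrank ℝ E' = Module.finrank ℝ E)
    (hq : ∀ x, π (j x) = q) (x : S) (w : TangentSpace 𝓘(ℝ, E) (j x))
    (hw : mfderiv 𝓘(ℝ, E) 𝓘(ℝ, E') π (j x) w = 0) :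
    ∃ v, mfderiv 𝓘(ℝ, F) 𝓘(ℝ, E) j x v = w := by
  have hcomp := mfderiv_comp x (hπ.contMDiff.mdifferentiableAt (x := j x) (by simp))
    (hj.contMDiff.mdifferentiableAt (x := x) (by simp))
  have hconst : π ∘ j = fun _ => q := funext hq
  rw [hconst, mfderiv_const] at hcomp
  let A : F →L[ℝ] E := mfderiv 𝓘(ℝ, F) 𝓘(ℝ, E) j x
  let B : E →L[ℝ] E' := mfderiv 𝓘(ℝ, E) 𝓘(ℝ, E') π (j x)
  exact exists_preimage_of_finrank (A := A.toLinearMap) (B := B.toLinearMap)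
    (injective_mfderiv hj x) (hπ.surjective_mfderiv (j x))
    (fun v => (DFunLike.congr_fun hcomp v).symm) hdim hw

/-- A vector field that is tangent to an embedded submanifold restricts to a smooth vector
field. -/
theorem contMDiff_restrict (g : RMetric E M) (V : VField E M) (W : Π x : S, TangentSpace 𝓘(ℝ, F) x)
    (hW : ∀ x, mfderiv 𝓘(ℝ, F) 𝓘(ℝ, E) j x (W x) = V (j x)) :
    ContMDiff 𝓘(ℝ, F) 𝓘(ℝ, F).tangent ∞ (fun x => (⟨x, W x⟩ : TangentBundle 𝓘(ℝ, F) S)) := by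
  intro x₀
  have hx₀ := mem_chart_source F x₀
  rw [contMDiffAt_field_iff hx₀]
  set p := j x₀ with hp
  have hp' : j x₀ ∈ (chartAt E p).source := mem_chart_source E p
  set i := localRep F E j x₀ p with hi
  have hD := isOpen_localDom (E := F) (E₂ := E) hj.contMDiff.continuous x₀ p
  have hy : chartAt F x₀ x₀ ∈ localDom F E j x₀ p := mem_localDom hx₀ hp'
  have hmF := isMetricOn_chartMetric (inducedMetric g j hj) x₀
  have hm := isMetricOn_chartMetric g p
  have hic : ContDiffAt ℝ ∞ i (chartAt F x₀ x₀) :=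
    (contDiffOn_localRep hj.contMDiff x₀ p).contDiffAt (hD.mem_nhds hy)
  have hiy : i (chartAt F x₀ x₀) ∈ (chartAt E p).target := (chartAt E p).map_source hy.2
  have hpre : ContDiffAt ℝ ∞ (fun L : F →L[ℝ] E => ContinuousLinearMap.precomp ℝ L)
      (fderiv ℝ i (chartAt F x₀ x₀)) :=
    (ContinuousLinearMap.compL ℝ F E ℝ).flip.contDiff.contDiffAt
  -- In charts `W` solves `GF(W, ·) = G(V, di ·)`. Inverting the smooth induced metric gives a
  -- smooth formula for it.
  have hsmooth : ContDiffAt ℝ ∞ (fun z => (chartMetric (inducedMetric g j hj) x₀ z).inverse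
      (ContinuousLinearMap.precomp ℝ (fderiv ℝ i z)
        (chartMetric g p (i z) (chartField V p (i z))))) (chartAt F x₀ x₀) :=
    (hmF.contDiffAt_inverse hy.1).clm_apply
      (((hpre.comp _ (contDiffAt_fderiv_top hic)).clm_apply
      (((hm.contDiffAt hiy).comp _ hic).clm_apply ((contDiffAt_chartField V hiy).comp _ hic))))
  refine (hsmooth.contMDiffAt.comp x₀ ((contMDiffOn_chart (I := 𝓘(ℝ, F)) (n := ∞)
    (x := x₀)).contMDiffAt ((chartAt F x₀).open_source.mem_nhds hx₀))).congr_of_eventuallyEq ?_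
  filter_upwards [(chartAt F x₀).open_source.mem_nhds hx₀,
    hj.contMDiff.continuous.continuousAt.preimage_mem_nhds
      ((chartAt E p).open_source.mem_nhds hp')] with x hx hjx
  simp only [Function.comp_apply]
  have hpos := hmF.pos _ ((chartAt F x₀).map_source hx)
  refine eq_of_posDef hpos fun w => ?_
  rw [apply_inverse_of_posDef hpos, chartMetric_inducedMetric hj hx hjx,
    fderiv_localRep hj.contMDiff hx hjx, hW, hi, localRep_chart p hx, chartField_chart _ hjx]
  rfl

/-- The Lie derivative of the metric is natural under restriction to embedded submanifolds that are
tangent to the vector field. -/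
theorem lieMetric_restrict (V : VField E M) (W : VField F S)
    (hW : ∀ x, mfderiv 𝓘(ℝ, F) 𝓘(ℝ, E) j x (W x) = V (j x)) (x : S)
    (u v : TangentSpace 𝓘(ℝ, F) x) :
    lieMetric g V (j x) (mfderiv 𝓘(ℝ, F) 𝓘(ℝ, E) j x u) (mfderiv 𝓘(ℝ, F) 𝓘(ℝ, E) j x v) =
      lieMetric (inducedMetric g j hj) W x u v := by
  have hx := mem_chart_source F x
  have hjx := mem_chart_source E (j x)
  have hD := isOpen_localDom (E := F) (E₂ := E) hj.contMDiff.continuous x (j x)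
  have hy : chartAt F x x ∈ localDom F E j x (j x) := mem_localDom hx hjx
  have hix : localRep F E j x (j x) (chartAt F x x) = chartAt E (j x) (j x) :=
    localRep_chart (j x) hx
  have hmF := isMetricOn_chartMetric (inducedMetric g j hj) x
  have hm := isMetricOn_chartMetric g (j x)
  have hnat := lieDeriv_naturality (φ := localRep F E j x (j x)) (y := chartAt F x x)
    (V₁ := chartField W x) (V₂ := chartField V (j x)) (hmF.differentiableAt hy.1)
    (by rw [hix]; exact hm.differentiableAt (mem_chart_target E _))
    ((contDiffOn_localRep hj.contMDiff x (j x)).contDiffAt (hD.mem_nhds hy))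
    (differentiableAt_of_contDiffAt_top (contDiffAt_chartField W hy.1))
    (by
      rw [hix]
      exact differentiableAt_of_contDiffAt_top (contDiffAt_chartField V (mem_chart_target E _)))
    (by
      filter_upwards [hD.mem_nhds hy]
      exact forall_localDom fun a ha hja => chartMetric_inducedMetric hj ha hja)
    (by
      filter_upwards [hD.mem_nhds hy]
      refine forall_localDom fun a ha hja => ?_
      rw [chartField_chart _ ha, fderiv_localRep hj.contMDiff ha hja, hW, localRep_chart _ ha,
        chartField_chart _ hja])
    (coordD x x u) (coordD x x v)
  simp only [fderiv_localRep hj.contMDiff hx hjx, hix] at hnat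
  exact hnat

variable [FiniteDimensional ℝ E']

/-- The Ricci tensor of a fiber is the restriction of the Ricci tensor, when the vertical
distribution is parallel. -/
theorem IsRiemannianSubmersion.ricci_fiber (hπ : IsRiemannianSubmersion g gN π)
    (hpar : VerticalParallel (E' := E') g π) (hq : ∀ x, π (j x) = q)
    (hker : ∀ x w, mfderiv 𝓘(ℝ, E) 𝓘(ℝ, E') π (j x) w = 0 →
      ∃ v, mfderiv 𝓘(ℝ, F) 𝓘(ℝ, E) j x v = w) (x : S) (u v : TangentSpace 𝓘(ℝ, F) x) :
    ricci g (j x) (mfderiv 𝓘(ℝ, F) 𝓘(ℝ, E) j x u) (mfderiv 𝓘(ℝ, F) 𝓘(ℝ, E) j x v) =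
      ricci (inducedMetric g j hj) x u v := by
  have hx := mem_chart_source F x
  have hjx := mem_chart_source E (j x)
  have h := (hπ.isFiberOn_localRep hj hq hker x (j x)).localRicci_fiber
    (hπ.isSubmersionOn_localRep (j x) q) (hpar.isVerticalParallelOn_localRep hπ (j x) q)
    (mem_localDom hx hjx) (coordD x x u) (coordD x x v)
  rw [fderiv_localRep hj.contMDiff hx hjx, fderiv_localRep hj.contMDiff hx hjx,
    localRep_chart _ hx] at h
  exact h

/-- The scalar curvature of the total space is the sum of the scalar curvatures of the fiber and of
the base, when the vertical distribution is parallel. -/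
theorem IsRiemannianSubmersion.scalar_fiber (hπ : IsRiemannianSubmersion g gN π)
    (hpar : VerticalParallel (E' := E') g π) (hq : ∀ x, π (j x) = q)
    (hker : ∀ x w, mfderiv 𝓘(ℝ, E) 𝓘(ℝ, E') π (j x) w = 0 →
      ∃ v, mfderiv 𝓘(ℝ, F) 𝓘(ℝ, E) j x v = w) (x : S) :
    scalar g (j x) = scalar (inducedMetric g j hj) x + scalar gN q := by
  have hx := mem_chart_source F x
  have hjx := mem_chart_source E (j x)
  have h := (hπ.isFiberOn_localRep hj hq hker x (j x)).localScalar_eq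
    (hπ.isSubmersionOn_localRep (j x) q) (hpar.isVerticalParallelOn_localRep hπ (j x) q)
    (mem_localDom hx hjx)
  rw [localRep_chart _ hx, localRep_chart _ hjx, hq] at h
  exact h

end Fibers

end RiemSoliton

/-! ### The soliton equations on the fiber. -/

theorem theorem4p3
    {E : Type*} [NormedAddCommGroup E] [NormedSpace ℝ E] [FiniteDimensional ℝ E]
    {M : Type*} [TopologicalSpace M] [T2Space M] [SecondCountableTopology M]
    [ChartedSpace E M] [IsManifold 𝓘(ℝ, E) ∞ M]
    {E' : Type*} [NormedAddCommGroup E'] [NormedSpace ℝ E'] [FiniteDimensional ℝ E']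
    {N : Type*} [TopologicalSpace N] [T2Space N] [SecondCountableTopology N]
    [ChartedSpace E' N] [IsManifold 𝓘(ℝ, E') ∞ N]
    (g : RMetric E M) (gN : RMetric E' N) (π : M → N) (hπ : IsRiemannianSubmersion g gN π)
    (hpar : VerticalParallel (E' := E') g π)
    (V : VField E M) (hV : IsVerticalOn (E' := E') π V Set.univ) (η : OneForm E M)
    (lam mu : ℝ) (q : N)
    -- the fiber over `q`, as an embedded submanifold of `M`
    {EF : Type*} [NormedAddCommGroup EF] [NormedSpace ℝ EF] [FiniteDimensional ℝ EF]
    [ChartedSpace EF (π ⁻¹' {q})] [IsManifold 𝓘(ℝ, EF) ∞ (π ⁻¹' {q})]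
    (hdim : Module.finrank ℝ EF + Module.finrank ℝ E' = Module.finrank ℝ E)
    (hF : Manifold.IsSmoothEmbedding 𝓘(ℝ, EF) 𝓘(ℝ, E) ∞ (Subtype.val : π ⁻¹' {q} → M)) :
    -- the potential field restricts to a smooth vector field `VF` on the fiber, with which
    ∃ VF : VField EF (π ⁻¹' {q}),
      (∀ x, mfderiv 𝓘(ℝ, EF) 𝓘(ℝ, E) (Subtype.val : π ⁻¹' {q} → M) x (VF x) = V x) ∧
      (IsEtaRicciYamabeSoliton g V η lam mu 1 0 →
        IsEtaRicciSoliton (inducedMetric g Subtype.val hF) VF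
          (inducedOneForm η Subtype.val hF.contMDiff) lam mu) ∧
      (IsEtaRicciYamabeSoliton g V η lam 0 1 0 →
        IsRicciSoliton (inducedMetric g Subtype.val hF) VF lam) ∧
      (IsEtaRicciYamabeSoliton g V η lam mu 0 1 →
        IsEtaYamabeSoliton (inducedMetric g Subtype.val hF) VF
          (inducedOneForm η Subtype.val hF.contMDiff) (lam - scalar gN q / 2) mu) ∧
      (IsEtaRicciYamabeSoliton g V η lam 0 0 1 →
        IsQuasiYamabeSoliton (inducedMetric g Subtype.val hF) VF (lam - scalar gN q / 2)) := by

  have hq : ∀ x : π ⁻¹' {q}, π (Subtype.val x) = q := fun x => x.2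
  have hker := hπ.exists_mfderiv_eq hF hdim hq
  choose W hW using fun x => hker x (V x) (hV _ trivial)
  let VF : VField EF (π ⁻¹' {q}) := ⟨W, contMDiff_restrict hF g V W hW⟩
  have hlie := lieMetric_restrict (g := g) hF V VF hW
  have hric := hπ.ricci_fiber hF hpar hq hker
  have hscal := hπ.scalar_fiber hF hpar hq hker
  refine ⟨VF, hW, fun h x u v => ?_, fun h x u v => ?_, fun h x u v => ?_, fun h x u v => ?_⟩ <;>
    have h1 := h x (mfderiv 𝓘(ℝ, EF) 𝓘(ℝ, E) (Subtype.val : π ⁻¹' {q} → M) x u)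
      (mfderiv 𝓘(ℝ, EF) 𝓘(ℝ, E) (Subtype.val : π ⁻¹' {q} → M) x v) <;>
    -- On vectors tangent to the fiber every term is now intrinsic to the fiber, apart from the
    -- additional `R_N(q)`. In type `(1, 0)` the scalar curvature has coefficient zero; in type `(0,
    -- 1)`, `2λ - R_F - R_N(q) = 2(λ - R_N(q)/2) - R_F`.
    rw [hlie, hric, hscal, ← inducedMetric_apply g Subtype.val hF] at h1
  -- The `η ⊗ η` terms agree by definition of the pull-back, which `rfl` supplies; only the other
  -- terms need algebra.
  · refine (congrArg₂ (· + ·) ?_ rfl).trans h1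
    ring
  · linarith
  · refine (congrArg₂ (· + ·) ?_ rfl).trans h1
    ring
  · linarith
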